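/- Conventions. A directed graph $E$ has vertices, edges, and source and range maps $s,r$; it is finite if it has finitely many vertices and edges. A path is a sequence of edges $\mu_1\cdots\mu_k$ with $r(\mu_i)=s(\mu_{i+1})$, of length $|\mu|=k$; each vertex is a path of length $0$. A cycle is a closed path $\mu_1\cdots\mu_k$, $k\ge 1$, with $s(\mu_i)\ne s(\mu_j)$ for $i\neq j$ (cycles that differ only by the starting vertex are identified). An exit of a cycle $\mu_1\cdots\mu_k$ is an edge $e$ with $s(e)=s(\mu_i)$ and $e\neq\mu_i$ for some $i$. A \emph{multi-headed comet} is a finite graph whose cycles are mutually disjoint and have no exits and in which every vertex is connected by a path to some cycle. For a ring $R$ with identity, the Leavitt path algebra $\mathcal L_R(E)$ is the $R$-algebra (coefficients commute with the generators, and it is regarded as a left $R$-module) generated by the vertices $v$, the edges $\alpha$ and symbols $\alpha^*$, subject to: $vw=\delta_{vw}v$ for vertices $v,w$; $s(\alpha)\alpha=\alpha r(\alpha)=\alpha$ and $r(\alpha)\alpha^*=\alpha^*s(\alpha)=\alpha^*$; $\alpha^*\beta=\delta_{\alpha\beta}\,r(\alpha)$; and $\sum_{s(\alpha)=v}\alpha\alpha^*=v$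 for every vertex $v$ that emits an edge. It is $\mathbb Z$-graded by $\deg v=0$, $\deg\alpha=1$, $\deg\alpha^*=-1$. The ring $R[x^l,x^{-l}]=\bigoplus_{i\in l\mathbb Z}Rx^i$ is $\mathbb Z$-graded with $\deg x^i=i$, and for a $\mathbb Z$-graded ring $A$ and $\delta\in\mathbb Z^n$, $\mathbb M_n(A)(\delta_1,\dots,\delta_n)$ is the matrix ring $\mathbb M_n(A)$ graded so that its component of degree $k$ consists of the matrices whose $(i,j)$-entry lies in $A_{k+\delta_j-\delta_i}$. A direct sum of graded rings is graded componentwise. Theorem. Let $R$ be a ring with identity and $E$ a multi-headed comet whose cycles are $C_1,\dots,C_t$, of lengths $l_1,\dots,l_t$. For each $s$ choose any vertex $v_s$ on $C_s$. Remove from $E$, for every $s$, the edge of $C_s$ with source $v_s$; in the resulting graph let $\{p^{v_s}_i\mid 1\le i\le n(v_s)\}$ be the set of all paths that end in $v_s$. These sets are finite, and for every enumeration of them there is a left $R$-linear isomorphism of $\mathbb Z$-graded rings $$\mathcal L_R(E)\;\cong_{\rm gr}\;\bigoplus_{s=1}^t \mathbb M_{n(v_s)}\big(R[x^{l_s},x^{-l_s}]\big)\big(|p^{v_s}_1|,\dots,|p^{v_s}_{n(v_s)}|\big).$$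 Furthermore, let $R$ be a division ring and let $F$ be another multi-headed comet, with cycles $C'_1,\dots,C'_k$ of lengths $l'_1,\dots,l'_k$, chosen vertices $u_s$ on $C'_s$, and paths $p^{u_s}_i$, $1\le i\le n(u_s)$, defined in the same way. Then the following conditions are equivalent: (a) $\mathcal L_R(E)$ and $\mathcal L_R(F)$ are isomorphic as $\mathbb Z$-graded rings; (b) they are isomorphic as $\mathbb Z$-graded rings by a left $R$-linear isomorphism; (c) $k=t$ and there is a permutation $\pi$ of $\{1,\dots,t\}$ such that for every $s$: $l_s=l'_{\pi(s)}$, $n(v_s)=n(u_{\pi(s)})$, and there are a bijection $\rho$ of $\{1,\dots,n(v_s)\}$, an integer $\sigma$ and elements $\tau_i\in l_s\mathbb Z$ with $$|p_i^{v_s}|=\big|p_{\rho(i)}^{u_{\pi(s)}}\big|+\tau_i+\sigma\qquad(1\le i\le n(v_s)).$$ -/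

import Mathlib

/-!
Directed graphs are Mathlib quivers: `V` is the set of vertices, `Quiver.Total V` the set of all
edges, with `e.left` the source and `e.right` the range of an edge `e`.  Paths are
`Quiver.Path`; the trivial path at `v` is `Quiver.Path.nil : Quiver.Path v v`.
-/

namespace LPA

section Graphs

universe u w

variable {V : Type u} [Quiver.{w} V]

/-- The sequence of edges of a path, in the order in which they are traversed. -/
def edges {a : V} : ∀ {b : V}, Quiver.Path a b → List (Quiver.Total V)
  | _, Quiver.Path.nil => []
  | _, Quiver.Path.cons (b := b) (c := c) p e => edges p ++ [⟨b, c, e⟩]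

/-- A closed path `μ₁ ⋯ μₖ`, `k ≥ 1`, is a cycle if `s(μᵢ) ≠ s(μⱼ)` for `i ≠ j`. -/
def IsCycle {a : V} (p : Quiver.Path a a) : Prop :=
  0 < p.length ∧ ((edges p).map Quiver.Total.left).Nodup

/-- Two closed paths are the same cycle (possibly started at different vertices). -/
def SameCycle {a b : V} (p : Quiver.Path a a) (q : Quiver.Path b b) : Prop :=
  (edges p).IsRotated (edges q)

/-- No vertex lies on both closed paths. -/
def DisjointCycles {a b : V} (p : Quiver.Path a a) (q : Quiver.Path b b) : Prop :=
  ∀ e ∈ edges p, ∀ f ∈ edges q, e.left ≠ f.left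

/-- `e` is an exit of `p`: it starts at a vertex `s(μᵢ)` of `p` and is not the edge `μᵢ`. -/
def IsExit {a : V} (p : Quiver.Path a a) (e : Quiver.Total V) : Prop :=
  ∃ f ∈ edges p, e.left = f.left ∧ e ≠ f

variable (V) in
/-- A multi-headed comet: a finite graph whose cycles are mutually disjoint and have no exits,
and in which every vertex is connected to a cycle. -/
structure IsMultiHeadedComet : Prop where
  finite_vertices : Finite V
  finite_edges : Finite (Quiver.Total V)
  disjoint : ∀ {a b : V} (p : Quiver.Path a a) (q : Quiver.Path b b), IsCycle p → IsCycle q →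
    SameCycle p q ∨ DisjointCycles p q
  connected_to_cycle : ∀ v : V, ∃ (a : V) (p : Quiver.Path a a), IsCycle p ∧ Nonempty (Quiver.Path v a)
  no_exit : ∀ {a : V} (p : Quiver.Path a a), IsCycle p → ∀ e : Quiver.Total V, ¬ IsExit p e

variable (V) in
/-- A list `C₁, …, Cₜ` of all the cycles of the graph (each listed exactly once), together with
a choice of a vertex `vₛ` on each `Cₛ`: the cycle is written as a closed path based at `vₛ`. -/
structure CycleChoice (t : ℕ) where
  base : Fin t → V
  cycle : ∀ s, Quiver.Path (base s) (base s)
  isCycle : ∀ s, IsCycle (cycle s)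
  complete : ∀ {a : V} (p : Quiver.Path a a), IsCycle p → ∃! s, SameCycle p (cycle s)

namespace CycleChoice

variable {t : ℕ} (C : CycleChoice V t)

/-- The length `lₛ` of the cycle `Cₛ`. -/
def len (s : Fin t) : ℕ := (C.cycle s).length

/-- The removed edges: for each `s`, the edge `cₛ` of `Cₛ` with source `vₛ`. -/
def removed : Set (Quiver.Total V) :=
  {e | ∃ s, e ∈ edges (C.cycle s) ∧ e.left = C.base s}

/-- The set of all paths that end in `vₛ`, in the graph without the removed edges. -/
def PathsTo (s : Fin t) : Type (max u w) :=
  {p : Σ a : V, Quiver.Path a (C.base s) // ∀ e ∈ edges p.2, e ∉ C.removed}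

/-- The number `n(vₛ)` of these paths. -/
noncomputable def n (s : Fin t) : ℕ := Nat.card (C.PathsTo s)

/-- An enumeration `p₁, …, p_{n(vₛ)}` of these paths, for every `s`. -/
abbrev PathEnum : Type (max u w) := ∀ s, Fin (C.n s) ≃ C.PathsTo s

/-- The list of lengths `|p₁|, …, |p_{n(vₛ)}|`. -/
def pathLengths {C : CycleChoice V t} (p : C.PathEnum) (s : Fin t) : Fin (C.n s) → ℤ :=
  fun i => ((p s i).1.2.length : ℤ)

end CycleChoice

end Graphs

section LeavittPathAlgebra

universe u w x

variable (R : Type x) [Ring R] (V : Type u) [Quiver.{w} V]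

/-- The generators `v`, `α`, `α*` of the Leavitt path algebra. -/
inductive Gen : Type (max u w)
  | vertex : V → Gen
  | edge : Quiver.Total V → Gen
  | ghost : Quiver.Total V → Gen

/-- The free (non-unital) ring with coefficients in `R` on the generators; the coefficients
commute with the generators. -/
abbrev FreeAlg : Type (max u w x) := MonoidAlgebra R (FreeSemigroup (Gen V))

variable {V} in
/-- A word in the generators as an element of the free ring. -/
noncomputable def word (m : FreeSemigroup (Gen V)) : FreeAlg R V := MonoidAlgebra.single m 1

variable {V} in
/-- The vertex `v` as an element of the free ring. -/
noncomputable def vtx (v : V) : FreeAlg R V := word R (FreeSemigroup.of (Gen.vertex v))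

variable {V} in
/-- The edge `e` as an element of the free ring. -/
noncomputable def edg (e : Quiver.Total V) : FreeAlg R V := word R (FreeSemigroup.of (Gen.edge e))

variable {V} in
/-- The ghost edge `e*` as an element of the free ring. -/
noncomputable def gho (e : Quiver.Total V) : FreeAlg R V := word R (FreeSemigroup.of (Gen.ghost e))

/-- The defining relations of the Leavitt path algebra.  The last one is imposed at the vertices
that emit at least one and only finitely many edges; `S` is the set of all edges with
source `v`. -/
inductive Rel : FreeAlg R V → FreeAlg R V → Prop
  | vertex_same (v : V) : Rel (vtx R v * vtx R v) (vtx R v)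
  | vertex_ne (v v' : V) : v ≠ v' → Rel (vtx R v * vtx R v') 0
  | source_edge (e : Quiver.Total V) : Rel (vtx R e.left * edg R e) (edg R e)
  | edge_range (e : Quiver.Total V) : Rel (edg R e * vtx R e.right) (edg R e)
  | range_ghost (e : Quiver.Total V) : Rel (vtx R e.right * gho R e) (gho R e)
  | ghost_source (e : Quiver.Total V) : Rel (gho R e * vtx R e.left) (gho R e)
  | ghost_edge_same (e : Quiver.Total V) : Rel (gho R e * edg R e) (vtx R e.right)
  | ghost_edge_ne (e f : Quiver.Total V) : e ≠ f → Rel (gho R e * edg R f) 0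
  | sum_edges (v : V) (S : Finset (Quiver.Total V)) : S.Nonempty → (∀ e, e ∈ S ↔ e.left = v) →
      Rel (∑ e ∈ S, edg R e * gho R e) (vtx R v)

/-- The congruence of `R`-algebras generated by the defining relations. -/
noncomputable def relCon : RingCon (FreeAlg R V) :=
  ringConGen fun a b => ∃ (r : R) (a' b' : FreeAlg R V), Rel R V a' b' ∧ a = r • a' ∧ b = r • b'

/-- The Leavitt path algebra `L_R(E)`, as a ring (not assumed to be unital). -/
abbrev Leavitt : Type (max u w x) := (relCon R V).Quotient

variable {R V} in
theorem relCon_smul (r : R) {a b : FreeAlg R V} (h : relCon R V a b) :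
    relCon R V (r • a) (r • b) := by
  induction h with
  | of a b h =>
    obtain ⟨s, a', b', h, rfl, rfl⟩ := h
    exact RingConGen.Rel.of _ _ ⟨r * s, a', b', h, smul_smul _ _ _, smul_smul _ _ _⟩
  | refl a => exact RingConGen.Rel.refl _
  | symm _ ih => exact RingConGen.Rel.symm ih
  | trans _ _ ih₁ ih₂ => exact RingConGen.Rel.trans ih₁ ih₂
  | add _ _ ih₁ ih₂ =>
    rw [smul_add, smul_add]
    exact RingConGen.Rel.add ih₁ ih₂
  | mul h₁ h₂ ih₁ ih₂ =>
    rw [← smul_mul_assoc, ← smul_mul_assoc]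
    exact RingConGen.Rel.mul ih₁ h₂

/-- The left `R`-module structure of `L_R(E)`. -/
noncomputable instance Leavitt.instModule : Module R (Leavitt R V) where
  smul r := Quotient.map' (fun a => r • a) fun _ _ h => relCon_smul r h
  one_smul a := Quotient.inductionOn' a fun a =>
    congrArg (RingCon.toQuotient (c := relCon R V)) (one_smul R a)
  mul_smul r s a := Quotient.inductionOn' a fun a =>
    congrArg (RingCon.toQuotient (c := relCon R V)) (mul_smul r s a)
  smul_zero r := congrArg (RingCon.toQuotient (c := relCon R V)) (smul_zero r)
  smul_add r a b := Quotient.inductionOn₂' a b fun a b =>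
    congrArg (RingCon.toQuotient (c := relCon R V)) (smul_add r a b)
  add_smul r s a := Quotient.inductionOn' a fun a =>
    congrArg (RingCon.toQuotient (c := relCon R V)) (add_smul r s a)
  zero_smul a := Quotient.inductionOn' a fun a =>
    congrArg (RingCon.toQuotient (c := relCon R V)) (zero_smul R a)

variable {V} in
/-- The degrees of the generators: `0` for vertices, `1` for edges, `-1` for ghost edges. -/
def genDegree : Gen V → ℤ
  | Gen.vertex _ => 0
  | Gen.edge _ => 1
  | Gen.ghost _ => -1

variable {V} in
/-- The degree of a word in the generators. -/
def wordDegree (m : FreeSemigroup (Gen V)) : ℤ :=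
  genDegree m.head + (m.tail.map genDegree).sum

/-- The homogeneous component `L_R(E)ₖ`: the image of the component of degree `k` of the free
ring, i.e. the left `R`-linear combinations of words of degree `k`. -/
noncomputable def Leavitt.grading (k : ℤ) : Submodule R (Leavitt R V) :=
  Submodule.span R {a | ∃ m : FreeSemigroup (Gen V), wordDegree m = k ∧
    a = RingCon.toQuotient (c := relCon R V) (word R m)}

end LeavittPathAlgebra

section MatrixRings

universe x

variable (R : Type x) [Ring R]

/-- The ring `R[xˡ, x⁻ˡ] = ⨁_{i ∈ lℤ} R xⁱ`, as the group ring of the subgroup `lℤ` of `ℤ`;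
`AddMonoidAlgebra.single i r` is `r xⁱ`. -/
abbrev LaurentPow (l : ℕ) : Type x := AddMonoidAlgebra R (AddSubgroup.zmultiples (l : ℤ))

/-- The component of degree `k` of `R[xˡ, x⁻ˡ]`: it is `R xᵏ` if `k ∈ lℤ`, and `0` otherwise. -/
noncomputable def LaurentPow.grading (l : ℕ) (k : ℤ) : Submodule R (LaurentPow R l) where
  carrier := {f | ∀ i, f.coeff i ≠ 0 → (i : ℤ) = k}
  add_mem' {f g} hf hg i hi := by
    by_contra hne
    have h₁ : f.coeff i = 0 := by_contra fun h => hne (hf i h)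
    have h₂ : g.coeff i = 0 := by_contra fun h => hne (hg i h)
    exact hi (by simp [h₁, h₂])
  zero_mem' i hi := by simp at hi
  smul_mem' r f hf i hi := hf i fun h => hi (by simp [h])

/-- The component of degree `k` of `Mₙ(R[xˡ, x⁻ˡ])(δ₁, …, δₙ)`: the matrices whose `ij`-entry is
homogeneous of degree `k + δⱼ - δᵢ`. -/
noncomputable def matGrading (l : ℕ) {n : ℕ} (δ : Fin n → ℤ) (k : ℤ) :
    Submodule R (Matrix (Fin n) (Fin n) (LaurentPow R l)) where
  carrier := {M | ∀ i j, M i j ∈ LaurentPow.grading R l (k + δ j - δ i)}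
  add_mem' hM hN i j := add_mem (hM i j) (hN i j)
  zero_mem' _ _ := zero_mem _
  smul_mem' r _ hM i j := Submodule.smul_mem _ r (hM i j)

/-- The direct sum of the rings `M_{n(s)}(R[x^{l(s)}, x^{-l(s)}])`, `1 ≤ s ≤ t`. -/
abbrev MatSum {t : ℕ} (l n : Fin t → ℕ) : Type x :=
  ∀ s, Matrix (Fin (n s)) (Fin (n s)) (LaurentPow R (l s))

/-- The component of degree `k` of the direct sum of the graded rings
`M_{n(s)}(R[x^{l(s)}, x^{-l(s)}])(δ(s)₁, …, δ(s)_{n(s)})`. -/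
noncomputable def matSumGrading {t : ℕ} (l n : Fin t → ℕ) (δ : ∀ s, Fin (n s) → ℤ) (k : ℤ) :
    Submodule R (MatSum R l n) :=
  Submodule.pi Set.univ fun s => matGrading R (l s) (δ s) k

end MatrixRings

section GradedIsomorphisms

universe x y z

variable {R : Type x} [Ring R] {A : Type y} [NonUnitalRing A] [Module R A]
  {B : Type z} [NonUnitalRing B] [Module R B]

/-- The `ℤ`-graded rings `A` and `B` are isomorphic as graded rings. -/
def GradedRingIso (𝒜 : ℤ → Submodule R A) (ℬ : ℤ → Submodule R B) : Prop :=
  ∃ φ : A ≃+* B, ∀ k a, φ a ∈ ℬ k ↔ a ∈ 𝒜 k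

/-- There is a graded ring isomorphism from `A` to `B` that is also left `R`-linear. -/
def GradedAlgIso (𝒜 : ℤ → Submodule R A) (ℬ : ℤ → Submodule R B) : Prop :=
  ∃ φ : A ≃+* B, (∀ (r : R) (a : A), φ (r • a) = r • φ a) ∧ ∀ k a, φ a ∈ ℬ k ↔ a ∈ 𝒜 k

end GradedIsomorphisms

/-- The list `δ` arises from the list `γ` by a permutation, by adding one integer `σ` to all
entries, and by adding elements of `lℤ` to the individual entries. -/
def ShiftRelated (l : ℕ) {n m : ℕ} (δ : Fin n → ℤ) (γ : Fin m → ℤ) : Prop :=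
  ∃ (π : Fin n ≃ Fin m) (σ : ℤ), ∀ i, ∃ τ ∈ AddSubgroup.zmultiples (l : ℤ),
    δ i = γ (π i) + τ + σ

end LPA

/-!
The Leavitt path algebra of a comet is compared with the sum of matrix rings through a basis.
A path to `vₛ` without removed edges is either trivial or a first edge followed by a shorter such
path; if the trivial path is replaced by the whole cycle `Cₛ`, then splitting off the first edge
becomes a bijection from these paths to all pairs of an edge and a path that can be composed with
it (`PathModel`, `CycleChoice.exists_pathModel`).  This uses that cycles have no exits, so that a
path which enters the cycle behind its removed edge can only follow the cycle.  The paths are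
finite in number because a path that leaves a vertex twice contains a cycle, hence a removed edge.

The bijection lets vertices, edges and ghost edges act by matrices with at most one nonzero entry in
each row, which is a power of `x^l` (`PathModel.act`, `rowMat`).  They satisfy the defining
relations, which gives a graded homomorphism to the sum of the matrix rings
(`PathModel.exists_leavitt_hom`).  The elements `i Cₛᵏ j*` of the Leavitt path algebra, for paths
`i`, `j` to `vₛ` and an integer `k`, are mapped to the matrix units `x^(k l) Eᵢⱼ`, which form a
basis.  The span of the `i Cₛᵏ j*` is stable under left multiplication by the generators, and it
contains every vertex because repeated use of `v = ∑ α α*` gives `v = ∑ i i*`, the sum over all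
paths `i` that start at `v` (`PathModel.vertex_eq_sum`).  Hence they span the algebra
(`PathModel.unitSpan_eq_top`) and the homomorphism is an isomorphism (`PathModel.gradedAlgIso`).

For the classification, related data give isomorphic matrix rings by a permutation of the indices
and a conjugation with a diagonal matrix of monomials (`exists_block_equiv`).  Conversely, call
idempotents `x`, `y` equivalent in degree `k` if `x = u v`, `y = v u` for `u`, `v` of degrees
`k`, `-k` in the corresponding corners.  The diagonal matrix units with indices `i`, `j` are
equivalent in degree `k` exactly if they lie in the same block and `k + δⱼ - δᵢ ∈ lℤ`
(`homogEquiv_diagUnit_iff`), so these relations determine all the data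
(`exists_shiftRelated_of_equiv`).  A graded ring isomorphism maps the diagonal matrix units to
orthogonal primitive idempotents of degree `0` with sum `1`.  In any such decomposition the number
of members equivalent to a given diagonal matrix unit is the `R`-dimension of the degree `0` part of
its row (`IsMatrixIdempotent.card_homogEquiv_eq_finrank`).  As this does not depend on the
decomposition, the images are the diagonal matrix units of the target up to a permutation and
equivalence in degree `0` (`exists_equiv_of_gradedRingIso`).
-/

namespace LPA

open Quiver

/-! ### Paths and their lists of edges -/

section Paths

universe u w

variable {V : Type u} [Quiver.{w} V]

@[simp] theorem edges_nil (a : V) : edges (Path.nil : Path a a) = [] := rfl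

@[simp] theorem edges_cons {a b c : V} (p : Path a b) (e : b ⟶ c) :
    edges (p.cons e) = edges p ++ [⟨b, c, e⟩] := rfl

@[simp] theorem length_edges {a b : V} (p : Path a b) : (edges p).length = p.length := by
  induction p with
  | nil => rfl
  | cons p e ih => simp [ih]

@[simp] theorem edges_comp {a b c : V} (p : Path a b) (q : Path b c) :
    edges (p.comp q) = edges p ++ edges q := by
  induction q with
  | nil => simp
  | cons q e ih => simp [ih]

@[simp] theorem edges_toPath {a b : V} (e : a ⟶ b) : edges e.toPath = [⟨a, b, e⟩] := rfl

/-- A path is either trivial or an edge followed by a path. -/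
theorem path_cases {b : V} (p : Σ a : V, Path a b) :
    p = ⟨b, Path.nil⟩ ∨
      ∃ (e : Total V) (q : Path e.right b), p = ⟨e.left, e.hom.toPath.comp q⟩ := by
  obtain ⟨a, p⟩ := p
  rcases Nat.eq_zero_or_pos p.length with h | h
  · obtain rfl := Path.eq_of_length_zero p h
    obtain rfl := Path.eq_nil_of_length_zero p h
    exact Or.inl rfl
  · obtain ⟨c, f, q, -, rfl⟩ := Path.eq_toPath_comp_of_length_eq_succ p
      (n := p.length - 1) (by lia)
    exact Or.inr ⟨⟨a, c, f⟩, q, rfl⟩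

theorem eq_nil_of_edges_eq_nil {b : V} {p : Σ a : V, Path a b} (h : edges p.2 = []) :
    p = ⟨b, Path.nil⟩ := by
  rcases path_cases p with rfl | ⟨e, q, rfl⟩
  · rfl
  · simp at h

theorem exists_of_edges_eq_cons {b : V} {p : Σ a : V, Path a b} {e : Total V}
    {L : List (Total V)} (h : edges p.2 = e :: L) :
    p.1 = e.left ∧ ∃ q : Path e.right b, edges q = L := by
  rcases path_cases p with rfl | ⟨e', q, rfl⟩
  · simp at h
  · simp only [edges_comp, edges_toPath, List.singleton_append, List.cons.injEq] at h
    obtain ⟨rfl, rfl⟩ := h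
    exact ⟨rfl, q, rfl⟩

theorem path_ext {b : V} {p q : Σ a : V, Path a b} (h : edges p.2 = edges q.2) : p = q := by
  generalize hL : edges q.2 = L at h
  induction L generalizing p q with
  | nil => rw [eq_nil_of_edges_eq_nil h, eq_nil_of_edges_eq_nil hL]
  | cons e L ih =>
    rcases path_cases p with rfl | ⟨e₁, p, rfl⟩
    · simp at h
    rcases path_cases q with rfl | ⟨e₂, q, rfl⟩
    · simp at hL
    simp only [edges_comp, edges_toPath, List.singleton_append, List.cons.injEq] at h hL
    obtain ⟨rfl, h⟩ := h
    obtain ⟨h₂, hL⟩ := hL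
    obtain rfl : e₁ = e₂ := h₂.symm
    have := ih (p := ⟨_, p⟩) (q := ⟨_, q⟩) hL h
    simp only [Sigma.mk.injEq, heq_eq_eq, true_and] at this
    rw [this]

/-- A path that visits the source of one of its edges can be cut there. -/
theorem exists_eq_comp_of_mem_left {a b v : V} (p : Path a b)
    (hv : v ∈ (edges p).map Total.left) :
    ∃ (p₁ : Path a v) (p₂ : Path v b), p = p₁.comp p₂ ∧ 0 < p₂.length := by
  induction p with
  | nil => simp at hv
  | cons p e ih =>
    simp only [edges_cons, List.map_append, List.map_cons, List.map_nil, List.mem_append,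
      List.mem_singleton] at hv
    rcases hv with hv | rfl
    · obtain ⟨p₁, p₂, rfl, h⟩ := ih hv
      exact ⟨p₁, p₂.cons e, rfl, by simp⟩
    · exact ⟨p, e.toPath, rfl, by simp⟩

/-- A path that leaves some vertex twice contains a cycle. -/
theorem exists_isCycle_of_not_nodup {a b : V} (p : Path a b)
    (hp : ¬ ((edges p).map Total.left).Nodup) :
    ∃ (c : V) (q : Path c c), IsCycle q ∧ edges q ⊆ edges p := by
  induction p with
  | nil => simp at hp
  | @cons b c p e ih =>
    by_cases h : ((edges p).map Total.left).Nodup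
    · have hb : b ∈ (edges p).map Total.left := by
        by_contra hb
        refine hp ?_
        rw [edges_cons, List.map_append, List.nodup_append]
        refine ⟨h, by simp, ?_⟩
        simp only [List.map_cons, List.map_nil, List.mem_singleton]
        rintro x hx y rfl rfl
        exact hb hx
      obtain ⟨p₁, p₂, rfl, h₂⟩ := exists_eq_comp_of_mem_left p hb
      rw [edges_comp, List.map_append, List.nodup_append] at h
      exact ⟨b, p₂, ⟨h₂, h.2.1⟩, by simp⟩
    · obtain ⟨c, q, hq, hs⟩ := ih h
      exact ⟨c, q, hq, fun x hx => by simp [hs hx]⟩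

end Paths

/-! ### Paths to the cycles of a comet -/

namespace CycleChoice

universe u w

variable {V : Type u} [Quiver.{w} V] {t : ℕ} (C : CycleChoice V t)

/-- The list of the cycles has no repetitions. -/
theorem not_sameCycle {s s' : Fin t} (h : s ≠ s') : ¬ SameCycle (C.cycle s) (C.cycle s') := by
  intro hs
  obtain ⟨r, -, hr⟩ := C.complete (C.cycle s) (C.isCycle s)
  exact h ((hr s (List.IsRotated.refl _)).trans (hr s' hs).symm)

/-- The cycle `Cₛ` is the removed edge followed by the rest of the cycle. -/
theorem exists_cycle_edges (s : Fin t) :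
    ∃ (e : Total V) (q : Path e.right (C.base s)),
      e.left = C.base s ∧ edges (C.cycle s) = e :: edges q := by
  rcases path_cases ⟨C.base s, C.cycle s⟩ with h | ⟨e, q, h⟩
  · have h₁ := (C.isCycle s).1
    simp only [Sigma.mk.injEq, heq_eq_eq, true_and] at h
    rw [h] at h₁
    simp at h₁
  · have h₁ : edges (C.cycle s) = e :: edges q :=
      (congrArg (fun p : Σ a : V, Path a (C.base s) => edges p.2) h).trans (by simp)
    exact ⟨e, q, (exists_of_edges_eq_cons (p := ⟨_, C.cycle s⟩) h₁).1.symm, h₁⟩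

/-- The removed edge of `Cₛ`. -/
noncomputable def cut (s : Fin t) : Total V := (C.exists_cycle_edges s).choose

theorem cut_left (s : Fin t) : (C.cut s).left = C.base s :=
  (C.exists_cycle_edges s).choose_spec.choose_spec.1

/-- What is left of the cycle `Cₛ` after its removed edge. -/
noncomputable def rest (s : Fin t) : Path (C.cut s).right (C.base s) :=
  (C.exists_cycle_edges s).choose_spec.choose

theorem cycle_edges (s : Fin t) : edges (C.cycle s) = C.cut s :: edges (C.rest s) :=
  (C.exists_cycle_edges s).choose_spec.choose_spec.2

theorem cut_mem_removed (s : Fin t) : C.cut s ∈ C.removed :=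
  ⟨s, by simp [C.cycle_edges s], C.cut_left s⟩

theorem rest_left_ne (s : Fin t) {e : Total V} (he : e ∈ edges (C.rest s)) :
    e.left ≠ C.base s := by
  have h := (C.isCycle s).2
  rw [C.cycle_edges s, List.map_cons, List.nodup_cons, C.cut_left] at h
  intro h'
  exact h.1 (List.mem_map.2 ⟨e, he, h'⟩)

variable {C} in
/-- On a comet the removed edge of `Cₛ` is the only edge that leaves `vₛ`. -/
theorem eq_cut_of_left_eq (hV : IsMultiHeadedComet V) {s : Fin t} {e : Total V}
    (h : e.left = C.base s) : e = C.cut s := by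
  by_contra hne
  exact hV.no_exit (C.cycle s) (C.isCycle s) e
    ⟨C.cut s, by simp [C.cycle_edges s], h.trans (C.cut_left s).symm, hne⟩

variable {C} in
theorem eq_of_left_eq_of_mem_rest (hV : IsMultiHeadedComet V) {s : Fin t} {e f : Total V}
    (hf : f ∈ edges (C.rest s)) (h : e.left = f.left) : e = f := by
  by_contra hne
  exact hV.no_exit (C.cycle s) (C.isCycle s) e ⟨f, by simp [C.cycle_edges s, hf], h, hne⟩

variable {C} in
theorem mem_removed_iff (hV : IsMultiHeadedComet V) {e : Total V} :
    e ∈ C.removed ↔ ∃ s, e = C.cut s := by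
  constructor
  · rintro ⟨s, -, h⟩
    exact ⟨s, eq_cut_of_left_eq hV h⟩
  · rintro ⟨s, rfl⟩
    exact C.cut_mem_removed s

variable {C} in
theorem base_injective (hV : IsMultiHeadedComet V) : Function.Injective C.base := by
  intro s s' h
  by_contra hne
  rcases hV.disjoint _ _ (C.isCycle s) (C.isCycle s') with h₁ | h₁
  · exact C.not_sameCycle hne h₁
  · exact h₁ (C.cut s) (by simp [C.cycle_edges s]) (C.cut s') (by simp [C.cycle_edges s'])
      (by rw [C.cut_left, C.cut_left, h])

variable {C} in
theorem rest_notMem_removed (hV : IsMultiHeadedComet V) (s : Fin t) :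
    ∀ e ∈ edges (C.rest s), e ∉ C.removed := by
  intro e he hr
  obtain ⟨s', rfl⟩ := (mem_removed_iff hV).1 hr
  by_cases hs : s = s'
  · subst hs
    exact C.rest_left_ne s he (C.cut_left s)
  · rcases hV.disjoint _ _ (C.isCycle s) (C.isCycle s') with h₁ | h₁
    · exact C.not_sameCycle hs h₁
    · exact h₁ (C.cut s') (by simp [C.cycle_edges s, he]) (C.cut s')
        (by simp [C.cycle_edges s']) rfl

/-- Every cycle contains a removed edge, so a path without removed edges leaves every vertex at
most once. -/
theorem nodup_of_notMem_removed {a b : V} (p : Path a b)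
    (hp : ∀ e ∈ edges p, e ∉ C.removed) : ((edges p).map Total.left).Nodup := by
  by_contra h
  obtain ⟨c, q, hq, hs⟩ := exists_isCycle_of_not_nodup p h
  obtain ⟨s, hr, -⟩ := C.complete q hq
  exact hp (C.cut s) (hs (hr.mem_iff.2 (by simp [C.cycle_edges s]))) (C.cut_mem_removed s)

theorem finite_pathsTo (hV : IsMultiHeadedComet V) (s : Fin t) : Finite (C.PathsTo s) := by
  have := hV.finite_edges
  have := Fintype.ofFinite (Total V)
  classical
  refine Finite.of_injective
    (fun p : C.PathsTo s =>
      (⟨edges p.1.2, (C.nodup_of_notMem_removed p.1.2 p.2).of_map⟩ :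
        {L : List (Total V) // L.Nodup})) ?_
  intro p q h
  exact Subtype.ext (path_ext (congrArg Subtype.val h))

/-- The trivial path at `vₛ`. -/
def nilPath (s : Fin t) : C.PathsTo s := ⟨⟨C.base s, Path.nil⟩, by simp⟩

variable {C} in
/-- The part of `Cₛ` after its removed edge, as a path to `vₛ` without removed edges. -/
noncomputable def restPath (hV : IsMultiHeadedComet V) (s : Fin t) : C.PathsTo s :=
  ⟨⟨_, C.rest s⟩, rest_notMem_removed hV s⟩

variable {C} in
theorem pathsTo_ext {s : Fin t} {i j : C.PathsTo s} (h : edges i.1.2 = edges j.1.2) : i = j :=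
  Subtype.ext (path_ext h)

variable {C} in
theorem pathsTo_cases {s : Fin t} (i : C.PathsTo s) :
    i = C.nilPath s ∨ ∃ (e : Total V) (j : C.PathsTo s), e ∉ C.removed ∧
      e.left = i.1.1 ∧ e.right = j.1.1 ∧ edges i.1.2 = e :: edges j.1.2 := by
  obtain ⟨i, hi⟩ := i
  rcases path_cases i with rfl | ⟨e, q, rfl⟩
  · exact Or.inl rfl
  · simp only [edges_comp, edges_toPath, List.singleton_append, List.mem_cons] at hi
    exact Or.inr ⟨e, ⟨⟨_, q⟩, fun f hf => hi f (Or.inr hf)⟩, hi e (Or.inl rfl), rfl, rfl, by simp⟩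

theorem exists_cons {s : Fin t} {e : Total V} (he : e ∉ C.removed) (j : C.PathsTo s)
    (hj : e.right = j.1.1) : ∃ i : C.PathsTo s, e.left = i.1.1 ∧
      edges i.1.2 = e :: edges j.1.2 := by
  obtain ⟨⟨b, q⟩, hq⟩ := j
  obtain ⟨a, b', f⟩ := e
  obtain rfl : b' = b := hj
  refine ⟨⟨⟨a, f.toPath.comp q⟩, ?_⟩, rfl, by simp⟩
  simp only [edges_comp, edges_toPath, List.singleton_append, List.mem_cons]
  rintro e (rfl | h)
  exacts [he, hq e h]

variable {C} in
/-- The trivial path is the only path without removed edges that starts at `vₛ`. -/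
theorem eq_nilPath_of_src_eq (hV : IsMultiHeadedComet V) {s s' : Fin t} (j : C.PathsTo s')
    (h : j.1.1 = C.base s) :
    (⟨s', j⟩ : Σ s, C.PathsTo s) = ⟨s, C.nilPath s⟩ := by
  rcases pathsTo_cases j with rfl | ⟨e, j', he, h₁, -, -⟩
  · obtain rfl := base_injective hV h
    rfl
  · exact absurd ((mem_removed_iff hV).2 ⟨s, eq_cut_of_left_eq hV (h₁.trans h)⟩) he

variable {C} in
/-- If no edge of the path `q` to `vₛ'` has a competitor at its source, then `q` is the only path
without removed edges that starts where `q` does. -/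
theorem eq_of_src_eq_of_forall_unique (hV : IsMultiHeadedComet V) {s s' : Fin t}
    (q : C.PathsTo s')
    (hq : ∀ f ∈ edges q.1.2, ∀ e : Total V, e.left = f.left → e = f)
    (j : C.PathsTo s) (h : j.1.1 = q.1.1) :
    (⟨s, j⟩ : Σ s, C.PathsTo s) = ⟨s', q⟩ := by
  generalize hL : edges q.1.2 = L
  induction L generalizing q j with
  | nil =>
    have : q = C.nilPath s' := pathsTo_ext hL
    subst this
    exact eq_nilPath_of_src_eq hV j h
  | cons f L ih =>
    rcases pathsTo_cases q with rfl | ⟨f', q', hf', h₁, h₂, h₃⟩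
    · simp [nilPath] at hL
    rcases pathsTo_cases j with rfl | ⟨e, j', he, h₄, h₅, h₆⟩
    · have h₇ : f' = C.cut s := eq_cut_of_left_eq hV (h₁.trans h.symm)
      exact absurd ((mem_removed_iff hV).2 ⟨s, h₇⟩) hf'
    · have h₇ : e = f' := hq f' (by simp [h₃]) e (by rw [h₁, h₄, h])
      subst h₇
      rw [h₃, List.cons.injEq] at hL
      have := ih q' (fun f hf => hq f (by simp [h₃, hf])) j' (by rw [← h₂, ← h₅]) hL.2
      obtain ⟨rfl, h₈⟩ := Sigma.mk.inj_iff.1 this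
      obtain rfl := eq_of_heq h₈
      rw [pathsTo_ext (h₆.trans h₃.symm)]

variable {C} in
/-- The first edge and the rest of a path to `vₛ`, where the trivial path is replaced by the whole
cycle `Cₛ`. -/
theorem exists_first_tail (hV : IsMultiHeadedComet V) {s : Fin t} (i : C.PathsTo s) :
    ∃ (e : Total V) (j : C.PathsTo s), e.left = i.1.1 ∧ e.right = j.1.1 ∧
      (i = C.nilPath s → e = C.cut s ∧ j = restPath hV s) ∧
      (i ≠ C.nilPath s → e ∉ C.removed ∧ edges i.1.2 = e :: edges j.1.2) := by
  by_cases hi : i = C.nilPath s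
  · subst hi
    exact ⟨C.cut s, restPath hV s, C.cut_left s, rfl, fun _ => ⟨rfl, rfl⟩, fun h => absurd rfl h⟩
  · rcases pathsTo_cases i with h | ⟨e, j, he, h₁, h₂, h₃⟩
    · exact absurd h hi
    · exact ⟨e, j, h₁, h₂, fun h => absurd h hi, fun _ => ⟨he, h₃⟩⟩

variable {C} in
/-- Every vertex is the source of a path to some `vₛ` without removed edges. -/
theorem exists_pathsTo (hV : IsMultiHeadedComet V) (v : V) :
    ∃ (s : Fin t) (i : C.PathsTo s), i.1.1 = v := by
  -- A path to a cycle `q = Cₛ` extends along the cycle to `vₛ`.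
  obtain ⟨s, p, -⟩ : ∃ (s : Fin t) (p : Path v (C.base s)), True := by
    obtain ⟨a, q, hq, ⟨p⟩⟩ := hV.connected_to_cycle v
    obtain ⟨s, hs, -⟩ := C.complete q hq
    have h : C.base s ∈ (edges q).map Total.left :=
      List.mem_map.2 ⟨C.cut s, hs.mem_iff.2 (by simp [C.cycle_edges s]), C.cut_left s⟩
    obtain ⟨q₁, -, -, -⟩ := exists_eq_comp_of_mem_left q h
    exact ⟨s, p.comp q₁, trivial⟩
  -- Cut the path at the first removed edge.
  generalize hL : edges p = L
  induction L generalizing v with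
  | nil =>
    have := eq_nil_of_edges_eq_nil (p := ⟨_, p⟩) hL
    exact ⟨s, C.nilPath s, (congrArg Sigma.fst this).symm⟩
  | cons e L ih =>
    obtain ⟨h₁, q, hq⟩ := exists_of_edges_eq_cons (p := ⟨_, p⟩) hL
    obtain ⟨r, j, hj⟩ := ih e.right q hq
    by_cases he : e ∈ C.removed
    · obtain ⟨s', hs', h⟩ := he
      exact ⟨s', C.nilPath s', h.symm.trans h₁.symm⟩
    · obtain ⟨i, hi, -⟩ := C.exists_cons he j hj.symm
      exact ⟨r, i, hi.symm.trans h₁.symm⟩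

end CycleChoice

/-- The combinatorial data of a comet that determine its Leavitt path algebra.  For each `s` the
indices `i : Fin (n s)` stand for the paths to `vₛ` without removed edges; `root s` is the trivial
path, `src` the source and `deg` the length.  A path `i ≠ root s` is the edge `first s i` followed
by the path `tail s i`; for `i = root s` the same holds for the cycle `Cₛ` in place of `i`, so that
`i ↦ (first s i, tail s i)` is a bijection to all pairs of an edge and a path that can be composed
with it. -/
structure PathModel (V : Type*) [Quiver V] {t : ℕ} (l n : Fin t → ℕ) where
  root : ∀ s, Fin (n s)
  src : ∀ s, Fin (n s) → V
  first : ∀ s, Fin (n s) → Total V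
  tail : ∀ s, Fin (n s) → Fin (n s)
  deg : ∀ s, Fin (n s) → ℕ
  first_left : ∀ s i, (first s i).left = src s i
  first_right : ∀ s i, (first s i).right = src s (tail s i)
  deg_root : ∀ s, deg s (root s) = 0
  deg_tail : ∀ s i, i ≠ root s → deg s i = deg s (tail s i) + 1
  deg_tail_root : ∀ s, l s = deg s (tail s (root s)) + 1
  ext : ∀ s i j, first s i = first s j → tail s i = tail s j → i = j
  exists_push : ∀ s e j, e.right = src s j → ∃ i, first s i = e ∧ tail s i = j
  eq_first_root : ∀ s e, e.left = src s (root s) → e = first s (root s)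
  src_eq_src_root : ∀ s s' i, src s' i = src s (root s) →
    (⟨s', i⟩ : Σ s, Fin (n s)) = ⟨s, root s⟩
  exists_src : ∀ v, ∃ s i, src s i = v

theorem CycleChoice.exists_pathModel {V : Type*} [Quiver V] (hV : IsMultiHeadedComet V) {t : ℕ}
    (C : CycleChoice V t) (p : C.PathEnum) :
    ∃ M : PathModel V C.len C.n, ∀ s i, (M.deg s i : ℤ) = pathLengths p s i := by
  choose first tail h₁ h₂ h₃ h₄ using
    fun s (i : C.PathsTo s) => CycleChoice.exists_first_tail hV i
  have hdeg (s : Fin t) (i : C.PathsTo s) (hi : i ≠ C.nilPath s) :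
      i.1.2.length = (tail s i).1.2.length + 1 := by
    rw [← length_edges, (h₄ s i hi).2, List.length_cons, length_edges]
  have hpush (s : Fin t) (e : Total V) (j : C.PathsTo s) (hj : e.right = j.1.1) :
      ∃ i, first s i = e ∧ tail s i = j := by
    by_cases he : e ∈ C.removed
    · -- Behind a removed edge there is only the rest of its cycle, and together they are the cycle.
      obtain ⟨s', rfl⟩ := (CycleChoice.mem_removed_iff hV).1 he
      have h := CycleChoice.eq_of_src_eq_of_forall_unique hV (CycleChoice.restPath hV s')
        (fun f hf e h => CycleChoice.eq_of_left_eq_of_mem_rest hV hf h) j hj.symm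
      obtain ⟨rfl, h⟩ := Sigma.mk.inj_iff.1 h
      obtain rfl := eq_of_heq h
      exact ⟨C.nilPath s, h₃ s _ rfl⟩
    · obtain ⟨i, hi, hij⟩ := C.exists_cons he j hj
      have hne : i ≠ C.nilPath s := by
        rintro rfl
        simp [CycleChoice.nilPath] at hij
      have h := (h₄ s i hne).2
      rw [hij, List.cons.injEq] at h
      exact ⟨i, h.1.symm, (CycleChoice.pathsTo_ext h.2).symm⟩
  -- The first edge tells whether `i` is trivial: it is a removed edge exactly in that case.
  have hext (s : Fin t) (i j : C.PathsTo s) (hf : first s i = first s j)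
      (ht : tail s i = tail s j) : i = j := by
    by_cases hi : i = C.nilPath s <;> by_cases hj : j = C.nilPath s
    · rw [hi, hj]
    · refine absurd ?_ (h₄ s j hj).1
      rw [← hf, (h₃ s i hi).1]
      exact C.cut_mem_removed s
    · refine absurd ?_ (h₄ s i hi).1
      rw [hf, (h₃ s j hj).1]
      exact C.cut_mem_removed s
    · refine CycleChoice.pathsTo_ext ?_
      rw [(h₄ s i hi).2, (h₄ s j hj).2, hf, ht]
  refine ⟨
    { root := fun s => (p s).symm (C.nilPath s)
      src := fun s i => (p s i).1.1
      first := fun s i => first s (p s i)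
      tail := fun s i => (p s).symm (tail s (p s i))
      deg := fun s i => (p s i).1.2.length
      first_left := fun s i => h₁ s _
      first_right := fun s i => by simpa using h₂ s _
      deg_root := fun s => by rw [Equiv.apply_symm_apply]; rfl
      deg_tail := fun s i hi => by
        rw [Equiv.apply_symm_apply]
        exact hdeg s _ fun h => hi (by rw [← h, Equiv.symm_apply_apply])
      deg_tail_root := fun s => by
        have h : (tail s (C.nilPath s)).1.2.length + 1 = C.len s := by
          rw [(h₃ s _ rfl).2, CycleChoice.len, ← length_edges (C.cycle s), C.cycle_edges,
            List.length_cons, length_edges]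
          rfl
        rw [Equiv.apply_symm_apply, Equiv.apply_symm_apply, h]
      ext := fun s i j hf ht => (p s).injective (hext s _ _ hf ((p s).symm.injective ht))
      exists_push := fun s e j hj => by
        obtain ⟨i, hi, hi'⟩ := hpush s e (p s j) hj
        exact ⟨(p s).symm i, by simpa using hi, by simp [hi']⟩
      eq_first_root := fun s e he => by
        simp only [Equiv.apply_symm_apply] at he ⊢
        rw [(h₃ s _ rfl).1]
        exact CycleChoice.eq_cut_of_left_eq hV he
      src_eq_src_root := fun s s' i hi => by
        simp only [Equiv.apply_symm_apply] at hi
        have h := CycleChoice.eq_nilPath_of_src_eq hV (p s' i) hi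
        obtain ⟨rfl, h⟩ := Sigma.mk.inj_iff.1 h
        rw [← eq_of_heq h, Equiv.symm_apply_apply]
      exists_src := fun v => by
        obtain ⟨s, i, hi⟩ := CycleChoice.exists_pathsTo (C := C) hV v
        exact ⟨s, (p s).symm i, by simpa using hi⟩ }, fun s i => rfl⟩

/-! ### Gradings of matrix rings over Laurent polynomials -/

section Gradings

universe x

variable {R : Type x} [Ring R]

theorem LaurentPow.single_mem_grading {l : ℕ} (z : AddSubgroup.zmultiples (l : ℤ)) (r : R) :
    (AddMonoidAlgebra.single z r : LaurentPow R l) ∈ LaurentPow.grading R l z := by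
  classical
  intro i hi
  rw [AddMonoidAlgebra.coeff_single, Finsupp.single_apply] at hi
  by_contra h
  exact hi (if_neg fun h' => h (by rw [h']))

/-- A homogeneous Laurent polynomial is zero or a monomial. -/
theorem LaurentPow.eq_zero_or_eq_single {l : ℕ} {k : ℤ} {f : LaurentPow R l}
    (hf : f ∈ LaurentPow.grading R l k) :
    f = 0 ∨ ∃ z : AddSubgroup.zmultiples (l : ℤ), (z : ℤ) = k ∧ ∃ r : R, r ≠ 0 ∧
      f = AddMonoidAlgebra.single z r := by
  classical
  by_cases h : f = 0
  · exact Or.inl h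
  · obtain ⟨z, hz⟩ : ∃ z, f.coeff z ≠ 0 := by
      by_contra! h'
      exact h (by ext z; exact h' z)
    refine Or.inr ⟨z, hf z hz, f.coeff z, hz, ?_⟩
    ext y
    rw [AddMonoidAlgebra.coeff_single, Finsupp.single_apply]
    split_ifs with hy
    · rw [hy]
    · by_contra hne
      exact hy (Subtype.ext ((hf z hz).trans (hf y hne).symm))

theorem LaurentPow.mul_mem_grading {l : ℕ} {k k' : ℤ} {f g : LaurentPow R l}
    (hf : f ∈ LaurentPow.grading R l k) (hg : g ∈ LaurentPow.grading R l k') :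
    f * g ∈ LaurentPow.grading R l (k + k') := by
  rcases LaurentPow.eq_zero_or_eq_single hf with rfl | ⟨z, rfl, r, -, rfl⟩
  · simp
  rcases LaurentPow.eq_zero_or_eq_single hg with rfl | ⟨z', rfl, r', -, rfl⟩
  · simp
  rw [AddMonoidAlgebra.single_mul_single]
  exact LaurentPow.single_mem_grading (z + z') _

theorem mul_mem_matGrading {l n : ℕ} {δ : Fin n → ℤ} {k k' : ℤ}
    {A B : Matrix (Fin n) (Fin n) (LaurentPow R l)} (hA : A ∈ matGrading R l δ k)
    (hB : B ∈ matGrading R l δ k') : A * B ∈ matGrading R l δ (k + k') := by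
  intro i j
  rw [Matrix.mul_apply]
  refine sum_mem fun m _ => ?_
  have h := LaurentPow.mul_mem_grading (hA i m) (hB m j)
  rwa [show k + δ m - δ i + (k' + δ j - δ m) = k + k' + δ j - δ i by ring] at h

theorem mem_matSumGrading {t : ℕ} {l n : Fin t → ℕ} {δ : ∀ s, Fin (n s) → ℤ} {k : ℤ}
    {A : MatSum R l n} : A ∈ matSumGrading R l n δ k ↔
      ∀ s i j, A s i j ∈ LaurentPow.grading R (l s) (k + δ s j - δ s i) :=
  ⟨fun h s => h s (Set.mem_univ s), fun h s _ => h s⟩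

theorem mul_mem_matSumGrading {t : ℕ} {l n : Fin t → ℕ} {δ : ∀ s, Fin (n s) → ℤ} {k k' : ℤ}
    {A B : MatSum R l n} (hA : A ∈ matSumGrading R l n δ k)
    (hB : B ∈ matSumGrading R l n δ k') : A * B ∈ matSumGrading R l n δ (k + k') :=
  fun s hs => mul_mem_matGrading (hA s hs) (hB s hs)

theorem single_zero_mul_eq_smul {l : ℕ} (r : R) (f : LaurentPow R l) :
    AddMonoidAlgebra.single 0 r * f = r • f := by
  ext z
  rw [AddMonoidAlgebra.coeff_single_zero_mul]
  rfl

/-- The matrix `xᶻ Eᵢⱼ` in the `s`-th summand. -/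
noncomputable def matUnit (R : Type x) [Ring R] {t : ℕ} {l n : Fin t → ℕ} (s : Fin t)
    (i j : Fin (n s)) (z : AddSubgroup.zmultiples (l s : ℤ)) : MatSum R l n :=
  Pi.single s (Matrix.single i j (AddMonoidAlgebra.single z 1))

theorem matUnit_mul_matUnit {t : ℕ} {l n : Fin t → ℕ} (s : Fin t) (i j k : Fin (n s))
    (z z' : AddSubgroup.zmultiples (l s : ℤ)) :
    matUnit R s i j z * matUnit R s j k z' = matUnit R s i k (z + z') := by
  rw [matUnit, matUnit, ← Pi.single_mul, Matrix.single_mul_single_same,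
    AddMonoidAlgebra.single_mul_single, one_mul, matUnit]

theorem single_single_eq_smul_matUnit {t : ℕ} {l n : Fin t → ℕ} (s : Fin t) (i j : Fin (n s))
    (z : AddSubgroup.zmultiples (l s : ℤ)) (r : R) :
    (Pi.single s (Matrix.single i j (AddMonoidAlgebra.single z r)) : MatSum R l n) =
      r • matUnit R s i j z := by
  rw [matUnit, ← Pi.single_smul, Matrix.smul_single, AddMonoidAlgebra.smul_single, smul_eq_mul,
    mul_one]

theorem span_matUnit {t : ℕ} (l n : Fin t → ℕ) :
    Submodule.span R (Set.range fun x : Σ s, Fin (n s) × Fin (n s) ×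
      AddSubgroup.zmultiples (l s : ℤ) => (matUnit R x.1 x.2.1 x.2.2.1 x.2.2.2 : MatSum R l n)) =
        ⊤ := by
  rw [eq_top_iff]
  rintro A -
  rw [← Finset.univ_sum_single A]
  refine sum_mem fun s _ => ?_
  have h (i j : Fin (n s)) (f : LaurentPow R (l s)) :
      (Pi.single s (Matrix.single i j f) : MatSum R l n) ∈
        Submodule.span R (Set.range fun x : Σ s, Fin (n s) × Fin (n s) ×
          AddSubgroup.zmultiples (l s : ℤ) =>
            (matUnit R x.1 x.2.1 x.2.2.1 x.2.2.2 : MatSum R l n)) := by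
    induction f using AddMonoidAlgebra.induction_linear with
    | zero => simp
    | add f g hf hg =>
      rw [Matrix.single_add, Pi.single_add]
      exact add_mem hf hg
    | single z r =>
      rw [single_single_eq_smul_matUnit]
      exact Submodule.smul_mem _ _ (Submodule.subset_span ⟨⟨s, i, j, z⟩, rfl⟩)
  rw [Matrix.matrix_eq_sum_single (A s)]
  have hsum {ι : Type} (S : Finset ι) (B : ι → Matrix (Fin (n s)) (Fin (n s)) (LaurentPow R (l s))) :
      (Pi.single s (∑ i ∈ S, B i) : MatSum R l n) = ∑ i ∈ S, Pi.single s (B i) :=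
    map_sum (AddMonoidHom.single
      (fun s => Matrix (Fin (n s)) (Fin (n s)) (LaurentPow R (l s))) s) B S
  rw [hsum]
  refine sum_mem fun i _ => ?_
  rw [hsum]
  exact sum_mem fun j _ => h i j _

end Gradings

/-! ### Row-monomial matrices -/

section RowMonomial

variable (R : Type*) [Ring R] {I Z : Type*} [DecidableEq I] [AddCommGroup Z]

/-- The matrix whose `i`-th row is zero if `f i = none`, and has the single entry `xᵃ` in column
`j` if `f i = some (j, a)`. -/
noncomputable def rowMat (f : I → Option (I × Z)) : Matrix I I (AddMonoidAlgebra R Z) :=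
  fun i => (f i).elim 0 fun p => Pi.single p.1 (AddMonoidAlgebra.single p.2 1)

variable {R}

theorem rowMat_none {f : I → Option (I × Z)} {i : I} (h : f i = none) (j : I) :
    rowMat R f i j = 0 := by
  simp [rowMat, h]

theorem rowMat_some {f : I → Option (I × Z)} {i k : I} {a : Z} (h : f i = some (k, a)) (j : I) :
    rowMat R f i j = if j = k then AddMonoidAlgebra.single a 1 else 0 := by
  simp [rowMat, h, Pi.single_apply]

variable [Fintype I]

theorem rowMat_mul_none {f : I → Option (I × Z)} {i : I} (h : f i = none)
    (B : Matrix I I (AddMonoidAlgebra R Z)) (j : I) : (rowMat R f * B) i j = 0 := by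
  simp [Matrix.mul_apply, rowMat_none h]

theorem rowMat_mul_some {f : I → Option (I × Z)} {i k : I} {a : Z} (h : f i = some (k, a))
    (B : Matrix I I (AddMonoidAlgebra R Z)) (j : I) :
    (rowMat R f * B) i j = AddMonoidAlgebra.single a 1 * B k j := by
  simp [Matrix.mul_apply, rowMat_some h]

theorem rowMat_mul_single {f : I → Option (I × Z)} {i j : I} {a : Z} (h : f i = some (j, a))
    (huniq : ∀ i' a', f i' = some (j, a') → i' = i) (k : I) (y : AddMonoidAlgebra R Z) :
    rowMat R f * Matrix.single j k y = Matrix.single i k (AddMonoidAlgebra.single a 1 * y) := by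
  ext1 i' k'
  by_cases hi : i' = i
  · subst hi
    rw [rowMat_mul_some h]
    by_cases hk : k = k' <;> simp [hk]
  · rw [Matrix.single_apply_of_row_ne (Ne.symm hi)]
    rcases h' : f i' with _ | ⟨j', a'⟩
    · exact rowMat_mul_none h' _ _
    · have hj : j ≠ j' := by
        rintro rfl
        exact hi (huniq i' a' h')
      rw [rowMat_mul_some h', Matrix.single_apply_of_row_ne hj, mul_zero]

theorem single_mul_rowMat {f : I → Option (I × Z)} {j k : I} {a : Z} (h : f j = some (k, a))
    (i : I) (y : AddMonoidAlgebra R Z) :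
    Matrix.single i j y * rowMat R f = Matrix.single i k (y * AddMonoidAlgebra.single a 1) := by
  ext1 i' k'
  by_cases hi : i = i'
  · subst hi
    rw [Matrix.single_mul_apply_same, rowMat_some h]
    by_cases hk : k' = k
    · subst hk
      simp
    · simp [hk, Matrix.single_apply_of_col_ne _ _ (Ne.symm hk)]
  · rw [Matrix.single_mul_apply_of_ne _ _ _ _ _ (Ne.symm hi), Matrix.single_apply_of_row_ne hi]

end RowMonomial

/-! ### Generators and relations of the Leavitt path algebra -/

section Leavitt

universe u w x

variable (R : Type x) [Ring R] {V : Type u} [Quiver.{w} V]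

/-- The class of a word in the generators. -/
noncomputable def leavittWord (m : FreeSemigroup (Gen V)) : Leavitt R V :=
  RingCon.toQuotient (c := relCon R V) (word R m)

/-- The vertex `v` in the Leavitt path algebra. -/
noncomputable def leavittVertex (v : V) : Leavitt R V :=
  leavittWord R (FreeSemigroup.of (Gen.vertex v))

/-- The edge `e` in the Leavitt path algebra. -/
noncomputable def leavittEdge (e : Total V) : Leavitt R V :=
  leavittWord R (FreeSemigroup.of (Gen.edge e))

/-- The ghost edge `e*` in the Leavitt path algebra. -/
noncomputable def leavittGhost (e : Total V) : Leavitt R V :=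
  leavittWord R (FreeSemigroup.of (Gen.ghost e))

theorem word_mul (m m' : FreeSemigroup (Gen V)) : word R (m * m') = word R m * word R m' := by
  simp [word, MonoidAlgebra.single_mul_single]

theorem leavittWord_mul (m m' : FreeSemigroup (Gen V)) :
    leavittWord R (m * m') = leavittWord R m * leavittWord R m' := by
  rw [leavittWord, word_mul]
  rfl

variable {R}

theorem toQuotient_eq_of_rel {a b : FreeAlg R V} (h : Rel R V a b) :
    RingCon.toQuotient (c := relCon R V) a = RingCon.toQuotient (c := relCon R V) b :=
  (RingCon.eq _).2 (RingConGen.Rel.of _ _ ⟨1, a, b, h, (one_smul R a).symm, (one_smul R b).symm⟩)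

theorem vertex_mul_vertex (v : V) :
    leavittVertex R v * leavittVertex R v = leavittVertex R v :=
  toQuotient_eq_of_rel (Rel.vertex_same v)

theorem vertex_mul_vertex_of_ne {v v' : V} (h : v ≠ v') :
    leavittVertex R v * leavittVertex R v' = 0 :=
  toQuotient_eq_of_rel (Rel.vertex_ne v v' h)

theorem left_mul_edge (e : Total V) :
    leavittVertex R e.left * leavittEdge R e = leavittEdge R e :=
  toQuotient_eq_of_rel (Rel.source_edge e)

theorem edge_mul_right (e : Total V) :
    leavittEdge R e * leavittVertex R e.right = leavittEdge R e :=
  toQuotient_eq_of_rel (Rel.edge_range e)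

theorem ghost_mul_left (e : Total V) :
    leavittGhost R e * leavittVertex R e.left = leavittGhost R e :=
  toQuotient_eq_of_rel (Rel.ghost_source e)

theorem ghost_mul_edge (e : Total V) :
    leavittGhost R e * leavittEdge R e = leavittVertex R e.right :=
  toQuotient_eq_of_rel (Rel.ghost_edge_same e)

theorem ghost_mul_edge_of_ne {e f : Total V} (h : e ≠ f) :
    leavittGhost R e * leavittEdge R f = 0 :=
  toQuotient_eq_of_rel (Rel.ghost_edge_ne e f h)

theorem toQuotient_sum {ι : Type*} (S : Finset ι) (f : ι → FreeAlg R V) :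
    RingCon.toQuotient (c := relCon R V) (∑ i ∈ S, f i) =
      ∑ i ∈ S, RingCon.toQuotient (c := relCon R V) (f i) := by
  classical
  induction S using Finset.induction_on with
  | empty => rfl
  | insert i S hi ih =>
    rw [Finset.sum_insert hi, Finset.sum_insert hi, ← ih]
    rfl

theorem sum_edge_mul_ghost {v : V} {S : Finset (Total V)} (hS : S.Nonempty)
    (h : ∀ e, e ∈ S ↔ e.left = v) :
    ∑ e ∈ S, leavittEdge R e * leavittGhost R e = leavittVertex R v := by
  have h' := toQuotient_eq_of_rel (R := R) (Rel.sum_edges v S hS h)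
  rw [toQuotient_sum] at h'
  exact h'

/-- Coefficients commute with words. -/
theorem word_mul_smul (m : FreeSemigroup (Gen V)) (r : R) (a : FreeAlg R V) :
    word R m * r • a = r • (word R m * a) := by
  induction a using MonoidAlgebra.induction_linear with
  | zero => simp
  | add a b ha hb => rw [smul_add, mul_add, mul_add, smul_add, ha, hb]
  | single m' r' => simp [word, MonoidAlgebra.smul_single, MonoidAlgebra.single_mul_single]

theorem leavittWord_mul_smul (m : FreeSemigroup (Gen V)) (r : R) (a : Leavitt R V) :
    leavittWord R m * r • a = r • (leavittWord R m * a) :=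
  Quotient.inductionOn' a fun a =>
    congrArg (RingCon.toQuotient (c := relCon R V)) (word_mul_smul m r a)

/-- The words span the Leavitt path algebra. -/
theorem span_leavittWord :
    Submodule.span R (Set.range (leavittWord R (V := V))) = ⊤ := by
  rw [eq_top_iff]
  rintro a -
  refine Quotient.inductionOn' a fun a => ?_
  change RingCon.toQuotient (c := relCon R V) a ∈ _
  induction a using MonoidAlgebra.induction_linear with
  | zero => exact zero_mem _
  | add a b ha hb => exact add_mem ha hb
  | single m r =>
    have h : (MonoidAlgebra.single m r : FreeAlg R V) = r • word R m := by
      rw [word, MonoidAlgebra.smul_single, smul_eq_mul, mul_one]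
    have hm : leavittWord R m ∈ Submodule.span R (Set.range (leavittWord R (V := V))) :=
      Submodule.subset_span (Set.mem_range_self m)
    rw [h]
    exact Submodule.smul_mem _ r hm

theorem wordDegree_mul (m m' : FreeSemigroup (Gen V)) :
    wordDegree (m * m') = wordDegree m + wordDegree m' := by
  simp [wordDegree]
  ring

variable (R) in
/-- `a` is the class of a word of degree `k`. -/
def IsWordOfDegree (k : ℤ) (a : Leavitt R V) : Prop :=
  ∃ m : FreeSemigroup (Gen V), wordDegree m = k ∧ a = leavittWord R m

theorem IsWordOfDegree.mul {k k' : ℤ} {a b : Leavitt R V} (ha : IsWordOfDegree R k a)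
    (hb : IsWordOfDegree R k' b) : IsWordOfDegree R (k + k') (a * b) := by
  obtain ⟨m, rfl, rfl⟩ := ha
  obtain ⟨m', rfl, rfl⟩ := hb
  exact ⟨m * m', wordDegree_mul m m', (leavittWord_mul R m m').symm⟩

theorem IsWordOfDegree.mem_grading {k : ℤ} {a : Leavitt R V} (ha : IsWordOfDegree R k a) :
    a ∈ Leavitt.grading R V k :=
  Submodule.subset_span ha

theorem isWordOfDegree_vertex (v : V) : IsWordOfDegree R 0 (leavittVertex R v) :=
  ⟨_, by simp [wordDegree, genDegree], rfl⟩

theorem isWordOfDegree_edge (e : Total V) : IsWordOfDegree R 1 (leavittEdge R e) :=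
  ⟨_, by simp [wordDegree, genDegree], rfl⟩

theorem isWordOfDegree_ghost (e : Total V) : IsWordOfDegree R (-1) (leavittGhost R e) :=
  ⟨_, by simp [wordDegree, genDegree], rfl⟩

/-- A left `R`-linear map out of the Leavitt path algebra, from images of the generators that
commute with the coefficients and satisfy the defining relations. -/
theorem exists_leavitt_lift {B : Type*} [Ring B] [Module R B] (c : R →+* B)
    (hc : ∀ r b, c r * b = r • b) (g : Gen V → B) (hg : ∀ r y, Commute (c r) (g y))
    (hrel : ∀ f : FreeAlg R V →ₙ+* B,
      (∀ m, f (word R m) = FreeSemigroup.lift g m) → ∀ a b, Rel R V a b → f a = f b) :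
    ∃ φ : Leavitt R V →ₗ[R] B, (∀ a b, φ (a * b) = φ a * φ b) ∧
      ∀ m, φ (leavittWord R m) = FreeSemigroup.lift g m := by
  have hcomm (r : R) (m : FreeSemigroup (Gen V)) : Commute (c r) (FreeSemigroup.lift g m) := by
    induction m using FreeSemigroup.recOnMul with
    | ih1 y => simpa using hg r y
    | ih2 y m hy hm =>
      rw [map_mul]
      exact hy.mul_right hm
  let f : FreeAlg R V →ₙ+* B :=
    { MonoidAlgebra.liftNC (c : R →+ B) (FreeSemigroup.lift g) with
      map_zero' := map_zero _
      map_mul' := fun a b => MonoidAlgebra.liftNC_mul c (FreeSemigroup.lift g) a b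
        fun _ => hcomm _ _ }
  have hf (m : FreeSemigroup (Gen V)) (r : R) :
      f (MonoidAlgebra.single m r) = r • FreeSemigroup.lift g m :=
    (MonoidAlgebra.liftNC_single _ _ _ _).trans (hc _ _)
  have hsmul (r : R) (a : FreeAlg R V) : f (r • a) = r • f a := by
    induction a using MonoidAlgebra.induction_linear with
    | zero => simp
    | add a b ha hb => rw [smul_add, map_add, map_add, smul_add, ha, hb]
    | single m' r' => rw [MonoidAlgebra.smul_single, hf, hf, smul_smul, smul_eq_mul]
  have hword (m : FreeSemigroup (Gen V)) : f (word R m) = FreeSemigroup.lift g m :=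
    (hf m 1).trans (one_smul _ _)
  have hwd (a b : FreeAlg R V) (h : relCon R V a b) : f a = f b := by
    induction h with
    | of a b h =>
      obtain ⟨r, a', b', h, rfl, rfl⟩ := h
      rw [hsmul, hsmul, hrel f hword _ _ h]
    | refl a => rfl
    | symm _ ih => exact ih.symm
    | trans _ _ ih₁ ih₂ => exact ih₁.trans ih₂
    | add _ _ ih₁ ih₂ => rw [map_add, map_add, ih₁, ih₂]
    | mul _ _ ih₁ ih₂ => rw [map_mul, map_mul, ih₁, ih₂]
  refine ⟨
    { toFun := fun a => Quotient.liftOn' a f hwd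
      map_add' := fun a b => Quotient.inductionOn₂' a b fun a b => map_add f a b
      map_smul' := fun r a => Quotient.inductionOn' a fun a => hsmul r a },
    fun a b => Quotient.inductionOn₂' a b fun a b => map_mul f a b, hword⟩

end Leavitt

/-! ### The representation of the Leavitt path algebra by matrices -/

section RowMonomialProducts

variable {R : Type*} [Ring R] {I Z : Type*} [DecidableEq I] [AddCommGroup Z]

/-- The product of row-monomial matrices, as an operation on the functions that encode them. -/
def rowComp (f g : I → Option (I × Z)) (i : I) : Option (I × Z) :=
  (f i).bind fun p => (g p.1).map fun q => (q.1, p.2 + q.2)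

theorem rowMat_mul [Fintype I] (f g : I → Option (I × Z)) :
    rowMat R f * rowMat R g = rowMat R (rowComp f g) := by
  ext1 i j
  rcases hf : f i with _ | ⟨k, a⟩
  · rw [rowMat_mul_none hf, rowMat_none (by simp [rowComp, hf])]
  · rw [rowMat_mul_some hf]
    rcases hg : g k with _ | ⟨m, b⟩
    · rw [rowMat_none hg, rowMat_none (by simp [rowComp, hf, hg]), mul_zero]
    · rw [rowMat_some hg, rowMat_some (k := m) (a := a + b) (by simp [rowComp, hf, hg])]
      split_ifs
      · rw [AddMonoidAlgebra.single_mul_single, one_mul]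
      · rw [mul_zero]

end RowMonomialProducts

namespace PathModel

open scoped Classical in
section

universe u w x

variable (R : Type x) [Ring R] {V : Type u} [Quiver.{w} V] {t : ℕ} {l n : Fin t → ℕ}
  (M : PathModel V l n)

/-- The path that consists of the edge `e` and the path `j`; it is `root s` if that is `Cₛ`. -/
noncomputable def push (s : Fin t) (e : Total V) (j : Fin (n s)) (h : e.right = M.src s j) :
    Fin (n s) := (M.exists_push s e j h).choose

theorem first_push {s : Fin t} {e : Total V} {j : Fin (n s)} (h : e.right = M.src s j) :
    M.first s (M.push s e j h) = e := (M.exists_push s e j h).choose_spec.1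

theorem tail_push {s : Fin t} {e : Total V} {j : Fin (n s)} (h : e.right = M.src s j) :
    M.tail s (M.push s e j h) = j := (M.exists_push s e j h).choose_spec.2

theorem push_eq {s : Fin t} {e : Total V} {i j : Fin (n s)} (h : e.right = M.src s j)
    (hf : M.first s i = e) (ht : M.tail s i = j) : M.push s e j h = i :=
  M.ext s _ _ ((M.first_push h).trans hf.symm) ((M.tail_push h).trans ht.symm)

theorem src_push {s : Fin t} {e : Total V} {j : Fin (n s)} (h : e.right = M.src s j) :
    M.src s (M.push s e j h) = e.left := by
  rw [← M.first_left, M.first_push]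

/-- The exponent `1` of `xˡ`. -/
def unitExp (l : ℕ) : AddSubgroup.zmultiples (l : ℤ) :=
  ⟨l, AddSubgroup.mem_zmultiples _⟩

/-- The exponent that is picked up when the first edge of the path `i` is split off: that edge
completes a turn of the cycle exactly if `i` is the trivial path. -/
noncomputable def turn (s : Fin t) (i : Fin (n s)) : AddSubgroup.zmultiples (l s : ℤ) :=
  if i = M.root s then unitExp (l s) else 0

/-- The action of the generators on the rows of the `s`-th matrix ring: `some (j, z)` at `i` stands
for the entry `xᶻ` in row `i` and column `j`.  The rows of an edge `e` that are not zero are those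
of the paths that begin with `e`, and the ghost edge `e*` acts as the partial inverse of `e`. -/
noncomputable def act (s : Fin t) :
    Gen V → Fin (n s) → Option (Fin (n s) × AddSubgroup.zmultiples (l s : ℤ))
  | Gen.vertex v => fun i => if M.src s i = v then some (i, 0) else none
  | Gen.edge e => fun i => if M.first s i = e then some (M.tail s i, M.turn s i) else none
  | Gen.ghost e => fun i => if h : e.right = M.src s i then
      some (M.push s e i h, - M.turn s (M.push s e i h)) else none

theorem act_vertex (s : Fin t) (v : V) (i : Fin (n s)) :
    M.act s (Gen.vertex v) i = if M.src s i = v then some (i, 0) else none := rfl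

theorem act_edge (s : Fin t) (e : Total V) (i : Fin (n s)) :
    M.act s (Gen.edge e) i =
      if M.first s i = e then some (M.tail s i, M.turn s i) else none := rfl

theorem act_ghost_some {s : Fin t} {e : Total V} {i : Fin (n s)} (h : e.right = M.src s i) :
    M.act s (Gen.ghost e) i = some (M.push s e i h, - M.turn s (M.push s e i h)) := dif_pos h

theorem act_ghost_none {s : Fin t} {e : Total V} {i : Fin (n s)} (h : e.right ≠ M.src s i) :
    M.act s (Gen.ghost e) i = none := dif_neg h

theorem rowComp_vertex_same (s : Fin t) (v : V) :
    rowComp (M.act s (Gen.vertex v)) (M.act s (Gen.vertex v)) = M.act s (Gen.vertex v) := by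
  funext i
  by_cases h : M.src s i = v <;> simp [rowComp, act_vertex, h]

theorem rowComp_vertex_ne (s : Fin t) {v v' : V} (hv : v ≠ v') :
    rowComp (M.act s (Gen.vertex v)) (M.act s (Gen.vertex v')) = fun _ => none := by
  funext i
  by_cases h : M.src s i = v <;> simp [rowComp, act_vertex, h, hv]

theorem rowComp_left_edge (s : Fin t) (e : Total V) :
    rowComp (M.act s (Gen.vertex e.left)) (M.act s (Gen.edge e)) = M.act s (Gen.edge e) := by
  funext i
  by_cases h : M.first s i = e
  · have h' : M.src s i = e.left := by rw [← h, M.first_left]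
    simp [rowComp, act_vertex, act_edge, h, h']
  · by_cases h' : M.src s i = e.left <;> simp [rowComp, act_vertex, act_edge, h, h']

theorem rowComp_edge_right (s : Fin t) (e : Total V) :
    rowComp (M.act s (Gen.edge e)) (M.act s (Gen.vertex e.right)) = M.act s (Gen.edge e) := by
  funext i
  by_cases h : M.first s i = e
  · have h' : M.src s (M.tail s i) = e.right := by rw [← h, M.first_right]
    simp [rowComp, act_vertex, act_edge, h, h']
  · simp [rowComp, act_edge, h]

theorem rowComp_right_ghost (s : Fin t) (e : Total V) :
    rowComp (M.act s (Gen.vertex e.right)) (M.act s (Gen.ghost e)) = M.act s (Gen.ghost e) := by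
  funext i
  by_cases h : e.right = M.src s i
  · simp [rowComp, act_vertex, h.symm, M.act_ghost_some h]
  · simp [rowComp, act_vertex, Ne.symm h, M.act_ghost_none h]

theorem rowComp_ghost_left (s : Fin t) (e : Total V) :
    rowComp (M.act s (Gen.ghost e)) (M.act s (Gen.vertex e.left)) = M.act s (Gen.ghost e) := by
  funext i
  by_cases h : e.right = M.src s i
  · simp [rowComp, M.act_ghost_some h, act_vertex, M.src_push h]
  · simp [rowComp, M.act_ghost_none h]

theorem rowComp_ghost_edge_same (s : Fin t) (e : Total V) :
    rowComp (M.act s (Gen.ghost e)) (M.act s (Gen.edge e)) = M.act s (Gen.vertex e.right) := by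
  funext i
  by_cases h : e.right = M.src s i
  · simp [rowComp, M.act_ghost_some h, act_edge, act_vertex, M.first_push h, M.tail_push h, h.symm]
  · simp [rowComp, M.act_ghost_none h, act_vertex, Ne.symm h]

theorem rowComp_ghost_edge_ne (s : Fin t) {e f : Total V} (hef : e ≠ f) :
    rowComp (M.act s (Gen.ghost e)) (M.act s (Gen.edge f)) = fun _ => none := by
  funext i
  by_cases h : e.right = M.src s i
  · simp [rowComp, M.act_ghost_some h, act_edge, M.first_push h, hef]
  · simp [rowComp, M.act_ghost_none h]

theorem rowComp_edge_ghost (s : Fin t) (e : Total V) (i : Fin (n s)) :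
    rowComp (M.act s (Gen.edge e)) (M.act s (Gen.ghost e)) i =
      if M.first s i = e then some (i, 0) else none := by
  by_cases h : M.first s i = e
  · have h' : e.right = M.src s (M.tail s i) := by rw [← h, M.first_right]
    simp [rowComp, act_edge, h, M.act_ghost_some h', M.push_eq h' h rfl]
  · simp [rowComp, act_edge, h]

/-- The images of the generators in the sum of the matrix rings. -/
noncomputable def genMat (g : Gen V) : MatSum R l n := fun s => rowMat R (M.act s g)

variable {R}

theorem genMat_mul_eq {g g' g'' : Gen V}
    (h : ∀ s, rowComp (M.act s g) (M.act s g') = M.act s g'') :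
    M.genMat R g * M.genMat R g' = M.genMat R g'' := by
  funext s
  rw [Pi.mul_apply, genMat, genMat, rowMat_mul, h]
  rfl

theorem genMat_mul_eq_zero {g g' : Gen V}
    (h : ∀ s, rowComp (M.act s g) (M.act s g') = fun _ => none) :
    M.genMat R g * M.genMat R g' = 0 := by
  funext s
  rw [Pi.mul_apply, genMat, genMat, rowMat_mul, h]
  rfl

/-- The row of a path `i` that starts at `v` comes from the summand of the first edge of `i`. -/
theorem sum_genMat {v : V} {S : Finset (Total V)} (hS : ∀ e, e ∈ S ↔ e.left = v) :
    ∑ e ∈ S, M.genMat R (Gen.edge e) * M.genMat R (Gen.ghost e) =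
      M.genMat R (Gen.vertex v) := by
  funext s
  ext1 i j
  have h (e : Total V) : (M.genMat R (Gen.edge e) * M.genMat R (Gen.ghost e)) s i j =
      if M.first s i = e then (if j = i then 1 else 0) else 0 := by
    rw [Pi.mul_apply, genMat, genMat, rowMat_mul]
    split_ifs with h₁ h₂
    · rw [rowMat_some (k := i) (a := 0) (by rw [rowComp_edge_ghost, if_pos h₁]), if_pos h₂]
      rfl
    · rw [rowMat_some (k := i) (a := 0) (by rw [rowComp_edge_ghost, if_pos h₁]), if_neg h₂]
    · rw [rowMat_none (by rw [rowComp_edge_ghost, if_neg h₁])]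
  rw [Finset.sum_apply, Matrix.sum_apply]
  simp only [h]
  rw [Finset.sum_ite_eq]
  by_cases hv : M.src s i = v
  · rw [if_pos ((hS _).2 ((M.first_left s i).trans hv)), genMat,
      rowMat_some (k := i) (a := 0) (by rw [act_vertex, if_pos hv])]
    rfl
  · rw [if_neg fun h => hv ((M.first_left s i).symm.trans ((hS _).1 h)), genMat,
      rowMat_none (by rw [act_vertex, if_neg hv])]

theorem commute_scalar_rowMat {I Z : Type*} [Fintype I] [DecidableEq I] [AddCommGroup Z] (r : R)
    (f : I → Option (I × Z)) :
    Commute (Matrix.scalar I (AddMonoidAlgebra.single (0 : Z) r)) (rowMat R f) := by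
  refine Matrix.ext fun i j => ?_
  rw [Matrix.scalar_apply, Matrix.diagonal_mul, Matrix.mul_diagonal]
  rcases h : f i with _ | ⟨k, a⟩
  · rw [rowMat_none h, mul_zero, zero_mul]
  · rw [rowMat_some h]
    split_ifs
    · simp [AddMonoidAlgebra.single_mul_single]
    · rw [mul_zero, zero_mul]

/-- The homomorphism from the Leavitt path algebra to the sum of the matrix rings. -/
theorem exists_leavitt_hom (M : PathModel V l n) :
    ∃ φ : Leavitt R V →ₗ[R] MatSum R l n, (∀ a b, φ (a * b) = φ a * φ b) ∧
      ∀ m, φ (leavittWord R m) = FreeSemigroup.lift (M.genMat R) m := by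
  refine exists_leavitt_lift
    (RingHom.pi fun s => (Matrix.scalar (Fin (n s))).comp
      (AddMonoidAlgebra.singleZeroRingHom (R := R) (M := AddSubgroup.zmultiples (l s : ℤ))))
    ?_ (M.genMat R) ?_ ?_
  · intro r A
    funext s
    ext1 i j
    change ((Matrix.diagonal fun _ => AddMonoidAlgebra.single 0 r :
      Matrix (Fin (n s)) (Fin (n s)) (LaurentPow R (l s))) * A s) i j = r • A s i j
    rw [Matrix.diagonal_mul, single_zero_mul_eq_smul]
  · intro r g
    funext s
    exact commute_scalar_rowMat r (M.act s g)
  · intro f hf a b h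
    have hv (v : V) : f (vtx R v) = M.genMat R (Gen.vertex v) := by simp [vtx, hf]
    have he (e : Total V) : f (edg R e) = M.genMat R (Gen.edge e) := by simp [edg, hf]
    have hg (e : Total V) : f (gho R e) = M.genMat R (Gen.ghost e) := by simp [gho, hf]
    induction h with
    | vertex_same v =>
      rw [map_mul, hv, M.genMat_mul_eq fun s => M.rowComp_vertex_same s v]
    | vertex_ne v v' h =>
      rw [map_mul, hv, hv, map_zero, M.genMat_mul_eq_zero fun s => M.rowComp_vertex_ne s h]
    | source_edge e => rw [map_mul, hv, he, M.genMat_mul_eq fun s => M.rowComp_left_edge s e]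
    | edge_range e => rw [map_mul, hv, he, M.genMat_mul_eq fun s => M.rowComp_edge_right s e]
    | range_ghost e => rw [map_mul, hv, hg, M.genMat_mul_eq fun s => M.rowComp_right_ghost s e]
    | ghost_source e => rw [map_mul, hv, hg, M.genMat_mul_eq fun s => M.rowComp_ghost_left s e]
    | ghost_edge_same e =>
      rw [map_mul, hg, he, hv, M.genMat_mul_eq fun s => M.rowComp_ghost_edge_same s e]
    | ghost_edge_ne e e' h =>
      rw [map_mul, hg, he, map_zero, M.genMat_mul_eq_zero fun s => M.rowComp_ghost_edge_ne s h]
    | sum_edges v S hS h =>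
      rw [map_sum, hv, ← M.sum_genMat h]
      exact Finset.sum_congr rfl fun e _ => by rw [map_mul, he, hg]

theorem coe_turn_root (s : Fin t) : ((M.turn s (M.root s) : _) : ℤ) = l s := by
  rw [turn, if_pos rfl]
  rfl

/-- The turn exponents compensate the change of the path length. -/
theorem coe_turn (s : Fin t) (i : Fin (n s)) :
    (M.turn s i : ℤ) = 1 + M.deg s (M.tail s i) - M.deg s i := by
  by_cases h : i = M.root s
  · subst h
    rw [coe_turn_root, M.deg_root, M.deg_tail_root]
    push_cast
    ring
  · rw [turn, if_neg h, M.deg_tail s i h, ZeroMemClass.coe_zero]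
    push_cast
    ring

theorem genMat_mem_grading (g : Gen V) :
    M.genMat R g ∈ matSumGrading R l n (fun s i => (M.deg s i : ℤ)) (genDegree g) := by
  have key (s : Fin t) (i j : Fin (n s)) (a : AddSubgroup.zmultiples (l s : ℤ))
      (h : M.act s g i = some (j, a)) : (a : ℤ) = genDegree g + M.deg s j - M.deg s i := by
    cases g with
    | vertex v =>
      rw [act_vertex] at h
      split_ifs at h with hv
      obtain ⟨rfl, rfl⟩ : i = j ∧ 0 = a := by simpa using h
      simp [genDegree]
    | edge e =>
      rw [act_edge] at h
      split_ifs at h with he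
      obtain ⟨rfl, rfl⟩ : M.tail s i = j ∧ M.turn s i = a := by simpa using h
      rw [coe_turn, genDegree]
    | ghost e =>
      by_cases he : e.right = M.src s i
      · rw [M.act_ghost_some he] at h
        obtain ⟨rfl, rfl⟩ : M.push s e i he = j ∧ - M.turn s (M.push s e i he) = a := by
          simpa using h
        rw [NegMemClass.coe_neg, coe_turn, M.tail_push, genDegree]
        ring
      · simp [M.act_ghost_none he] at h
  rw [mem_matSumGrading]
  intro s i j
  rcases h : M.act s g i with _ | ⟨k, a⟩
  · rw [genMat, rowMat_none h]
    exact zero_mem _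
  · rw [genMat, rowMat_some h]
    split_ifs with hj
    · subst hj
      rw [← key s i j a h]
      exact LaurentPow.single_mem_grading a 1
    · exact zero_mem _

theorem lift_genMat_mem_grading (m : FreeSemigroup (Gen V)) :
    FreeSemigroup.lift (M.genMat R) m ∈
      matSumGrading R l n (fun s i => (M.deg s i : ℤ)) (wordDegree m) := by
  induction m using FreeSemigroup.recOnMul with
  | ih1 g => simpa [wordDegree] using M.genMat_mem_grading g
  | ih2 g m hg hm =>
    rw [map_mul, wordDegree_mul]
    exact mul_mem_matSumGrading hg hm

end

end PathModel

/-! ### A spanning set of the Leavitt path algebra -/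

section CornerPow

variable {A : Type*} [NonUnitalRing A]

/-- The power `cᵏ` of an element `c` of a corner with identity `v`. -/
def cornerPowNat (v c : A) : ℕ → A
  | 0 => v
  | k + 1 => c * cornerPowNat v c k

/-- The integral power `cᵏ` of an element `c` of a corner with identity `v` and inverse `d`; for
negative `k` it is the power of `d` with exponent `-k`. -/
def cornerPow (v c d : A) : ℤ → A
  | Int.ofNat k => cornerPowNat v c k
  | Int.negSucc k => cornerPowNat v d (k + 1)

variable {v c d : A}

theorem mul_cornerPow_of_mul_eq (hv : v * v = v) (hc : v * c = c) (hd : v * d = d) (k : ℤ) :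
    v * cornerPow v c d k = cornerPow v c d k := by
  rcases k with (_ | k) | k
  · exact hv
  · rw [cornerPow, cornerPowNat, ← mul_assoc, hc]
  · rw [cornerPow, cornerPowNat, ← mul_assoc, hd]

theorem mul_cornerPow (hv : v * v = v) (hd : v * d = d) (hcd : c * d = v) (k : ℤ) :
    c * cornerPow v c d k = cornerPow v c d (k + 1) := by
  rcases k with k | k
  · rfl
  · rw [cornerPow, cornerPowNat, ← mul_assoc, hcd]
    rcases k with _ | k
    · exact hv
    · rw [cornerPowNat, ← mul_assoc, hd]
      rfl

end CornerPow

namespace PathModel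

open scoped Classical in
section

universe u w x

variable (R : Type x) [Ring R] {V : Type u} [Quiver.{w} V] {t : ℕ} {l n : Fin t → ℕ}
  (M : PathModel V l n)

/-- The path `i`, as an element of the Leavitt path algebra. -/
noncomputable def mono (s : Fin t) (i : Fin (n s)) : Leavitt R V :=
  if _h : i = M.root s then leavittVertex R (M.src s i)
  else leavittEdge R (M.first s i) * mono s (M.tail s i)
termination_by M.deg s i
decreasing_by
  have := M.deg_tail s i ‹_›
  lia

/-- The ghost path `i*`, as an element of the Leavitt path algebra. -/
noncomputable def ghostMono (s : Fin t) (i : Fin (n s)) : Leavitt R V :=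
  if _h : i = M.root s then leavittVertex R (M.src s i)
  else ghostMono s (M.tail s i) * leavittGhost R (M.first s i)
termination_by M.deg s i
decreasing_by
  have := M.deg_tail s i ‹_›
  lia

theorem mono_root (s : Fin t) : M.mono R s (M.root s) = leavittVertex R (M.src s (M.root s)) := by
  rw [mono, dif_pos rfl]

theorem mono_of_ne {s : Fin t} {i : Fin (n s)} (h : i ≠ M.root s) :
    M.mono R s i = leavittEdge R (M.first s i) * M.mono R s (M.tail s i) := by
  rw [mono, dif_neg h]

theorem ghostMono_root (s : Fin t) :
    M.ghostMono R s (M.root s) = leavittVertex R (M.src s (M.root s)) := by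
  rw [ghostMono, dif_pos rfl]

theorem ghostMono_of_ne {s : Fin t} {i : Fin (n s)} (h : i ≠ M.root s) :
    M.ghostMono R s i = M.ghostMono R s (M.tail s i) * leavittGhost R (M.first s i) := by
  rw [ghostMono, dif_neg h]

/-- Induction on the length of a path to `vₛ`. -/
theorem tail_induction (M : PathModel V l n) {s : Fin t} {P : Fin (n s) → Prop}
    (hroot : P (M.root s))
    (htail : ∀ i, i ≠ M.root s → P (M.tail s i) → P i) (i : Fin (n s)) : P i := by
  induction h : M.deg s i using Nat.strong_induction_on generalizing i with
  | _ d ih =>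
    by_cases hi : i = M.root s
    · rwa [hi]
    · have := M.deg_tail s i hi
      exact htail i hi (ih _ (by lia) _ rfl)

/-- The cycle `Cₛ`, as an element of the Leavitt path algebra. -/
noncomputable def cyc (s : Fin t) : Leavitt R V :=
  leavittEdge R (M.first s (M.root s)) * M.mono R s (M.tail s (M.root s))

/-- The ghost cycle `Cₛ*`, as an element of the Leavitt path algebra. -/
noncomputable def ghostCyc (s : Fin t) : Leavitt R V :=
  M.ghostMono R s (M.tail s (M.root s)) * leavittGhost R (M.first s (M.root s))

/-- The power `Cₛᵏ`, as an element of the Leavitt path algebra. -/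
noncomputable def cycPow (s : Fin t) (k : ℤ) : Leavitt R V :=
  cornerPow (leavittVertex R (M.src s (M.root s))) (M.cyc R s) (M.ghostCyc R s) k

/-- The element `i Cₛᵏ j*` of the Leavitt path algebra, for paths `i` and `j` to `vₛ`. -/
noncomputable def unit (s : Fin t) (i : Fin (n s)) (k : ℤ) (j : Fin (n s)) : Leavitt R V :=
  M.mono R s i * (M.cycPow R s k * M.ghostMono R s j)

variable {R}

theorem src_mul_edge (s : Fin t) (i : Fin (n s)) :
    leavittVertex R (M.src s i) * leavittEdge R (M.first s i) = leavittEdge R (M.first s i) := by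
  rw [← M.first_left, left_mul_edge]

theorem src_mul_mono (s : Fin t) (i : Fin (n s)) :
    leavittVertex R (M.src s i) * M.mono R s i = M.mono R s i := by
  by_cases h : i = M.root s
  · subst h
    rw [mono_root, vertex_mul_vertex]
  · rw [mono_of_ne R M h, ← mul_assoc, src_mul_edge]

theorem root_mul_ghostMono (s : Fin t) (i : Fin (n s)) :
    leavittVertex R (M.src s (M.root s)) * M.ghostMono R s i = M.ghostMono R s i := by
  induction i using M.tail_induction with
  | hroot => rw [ghostMono_root, vertex_mul_vertex]
  | htail i hi ih => rw [ghostMono_of_ne R M hi, ← mul_assoc, ih]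

theorem root_mul_cyc (s : Fin t) :
    leavittVertex R (M.src s (M.root s)) * M.cyc R s = M.cyc R s := by
  rw [cyc, ← mul_assoc, src_mul_edge]

theorem root_mul_ghostCyc (s : Fin t) :
    leavittVertex R (M.src s (M.root s)) * M.ghostCyc R s = M.ghostCyc R s := by
  rw [ghostCyc, ← mul_assoc, root_mul_ghostMono]

theorem push_ne_root {s : Fin t} {e : Total V} {j : Fin (n s)} (h : e.right = M.src s j)
    (he : ∀ s', e.left ≠ M.src s' (M.root s')) : M.push s e j h ≠ M.root s := by
  intro h'
  exact he s (by rw [← h', M.src_push])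

/-- A sum over the paths `i` that start with a given vertex is a sum over their first edges and
tails. -/
theorem sum_first_tail {B : Type*} [AddCommMonoid B] (s : Fin t) {v : V} {S : Finset (Total V)}
    (hS : ∀ e, e ∈ S ↔ e.left = v) (F : Total V → Fin (n s) → B) :
    ∑ e ∈ S, ∑ j with M.src s j = e.right, F e j =
      ∑ i with M.src s i = v, F (M.first s i) (M.tail s i) := by
  rw [Finset.sum_sigma']
  symm
  refine Finset.sum_bij (fun i _ => ⟨M.first s i, M.tail s i⟩) ?_ ?_ ?_ ?_
  · intro i hi
    simp only [Finset.mem_filter, Finset.mem_univ, true_and] at hi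
    simp only [Finset.mem_sigma, Finset.mem_filter, Finset.mem_univ, true_and]
    exact ⟨(hS _).2 ((M.first_left s i).trans hi), (M.first_right s i).symm⟩
  · intro i _ j _ h
    simp only [Sigma.mk.injEq, heq_eq_eq] at h
    exact M.ext s i j h.1 h.2
  · rintro ⟨e, j⟩ h
    simp only [Finset.mem_sigma, Finset.mem_filter, Finset.mem_univ, true_and] at h
    refine ⟨M.push s e j h.2.symm, ?_, ?_⟩
    · simp only [Finset.mem_filter, Finset.mem_univ, true_and]
      rw [M.src_push, (hS _).1 h.1]
    · rw [M.first_push, M.tail_push]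
  · intro i _
    rfl

/-- Repeated application of the relation `v = ∑ α α*` until all paths have reached their `vₛ`. -/
theorem vertex_eq_sum [Finite (Total V)] (v : V) :
    leavittVertex R v =
      ∑ s, ∑ i with M.src s i = v, M.mono R s i * M.ghostMono R s i := by
  have := Fintype.ofFinite (Total V)
  obtain ⟨N, hN⟩ : ∃ N, ∀ s i, M.src s i = v → M.deg s i < N :=
    ⟨(∑ s, ∑ i, M.deg s i) + 1, fun s i _ => Nat.lt_succ_of_le
      ((Finset.single_le_sum (f := fun i => M.deg s i) (fun _ _ => Nat.zero_le _)
        (Finset.mem_univ i)).trans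
      (Finset.single_le_sum (f := fun s => ∑ i, M.deg s i) (fun _ _ => Nat.zero_le _)
        (Finset.mem_univ s)))⟩
  -- Induction on a bound for the lengths of the paths that start at `v`.
  induction N generalizing v with
  | zero =>
    obtain ⟨s, i, hi⟩ := M.exists_src v
    exact absurd (hN s i hi) (Nat.not_lt_zero _)
  | succ N ih =>
    by_cases hv : ∃ s, v = M.src s (M.root s)
    · obtain ⟨s, rfl⟩ := hv
      rw [Finset.sum_eq_single s, Finset.sum_eq_single (M.root s), mono_root, ghostMono_root,
        vertex_mul_vertex]
      · intro i hi hne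
        simp only [Finset.mem_filter, Finset.mem_univ, true_and] at hi
        exact absurd (by simpa using M.src_eq_src_root s s i hi) hne
      · intro h
        simp at h
      · intro s' _ hne
        refine Finset.sum_eq_zero fun i hi => ?_
        simp only [Finset.mem_filter, Finset.mem_univ, true_and] at hi
        exact absurd (Sigma.mk.inj_iff.1 (M.src_eq_src_root s s' i hi)).1 hne
      · intro h
        simp at h
    · push Not at hv
      have hS (e : Total V) : e ∈ Finset.univ.filter (fun e : Quiver.Total V => e.left = v) ↔
          e.left = v := by simp
      obtain ⟨s₀, i₀, hi₀⟩ := M.exists_src v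
      rw [← sum_edge_mul_ghost ⟨M.first s₀ i₀, (hS _).2 ((M.first_left s₀ i₀).trans hi₀)⟩ hS]
      have hstep (e : Total V) (he : e.left = v) :
          leavittEdge R e * leavittGhost R e = ∑ s, ∑ j with M.src s j = e.right,
            leavittEdge R e * M.mono R s j * (M.ghostMono R s j * leavittGhost R e) := by
        have hright : leavittEdge R e * leavittGhost R e =
            leavittEdge R e * leavittVertex R e.right * leavittGhost R e := by
          rw [edge_mul_right]
        rw [hright, ih e.right, Finset.mul_sum, Finset.sum_mul]
        · refine Finset.sum_congr rfl fun s _ => ?_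
          rw [Finset.mul_sum, Finset.sum_mul]
          simp only [mul_assoc]
        · intro s j hj
          have h := M.deg_tail s (M.push s e j hj.symm)
            (M.push_ne_root hj.symm fun s' => by rw [he]; exact hv s')
          rw [M.tail_push] at h
          have h' := hN s (M.push s e j hj.symm) (by rw [M.src_push, he])
          lia
      rw [Finset.sum_congr rfl fun e he => hstep e ((hS e).1 he), Finset.sum_comm]
      refine Finset.sum_congr rfl fun s _ => ?_
      rw [M.sum_first_tail s hS fun e j =>
        leavittEdge R e * M.mono R s j * (M.ghostMono R s j * leavittGhost R e)]
      refine Finset.sum_congr rfl fun i hi => ?_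
      simp only [Finset.mem_filter, Finset.mem_univ, true_and] at hi
      have hne : i ≠ M.root s := fun h => hv s (by rw [← hi, h])
      rw [mono_of_ne R M hne, ghostMono_of_ne R M hne]

/-- As cycles have no exits, the relation `v = ∑ α α*` has a single summand along the cycle. -/
theorem cyc_mul_ghostCyc [Finite (Total V)] (s : Fin t) :
    M.cyc R s * M.ghostCyc R s = leavittVertex R (M.src s (M.root s)) := by
  set e := M.first s (M.root s) with he
  have hright : leavittVertex R e.right =
      M.mono R s (M.tail s (M.root s)) * M.ghostMono R s (M.tail s (M.root s)) := by
    -- The rest of the cycle is the only path that starts at the range of its first edge.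
    have huniq (s' : Fin t) (j : Fin (n s')) (hj : M.src s' j = e.right) :
        (⟨s', j⟩ : Σ s, Fin (n s)) = ⟨s, M.tail s (M.root s)⟩ := by
      have h := M.src_eq_src_root s s' (M.push s' e j hj.symm)
        (by rw [M.src_push, he, M.first_left])
      obtain ⟨rfl, h⟩ := Sigma.mk.inj_iff.1 h
      rw [← eq_of_heq h, M.tail_push]
    rw [M.vertex_eq_sum, Finset.sum_eq_single s, Finset.sum_eq_single (M.tail s (M.root s))]
    · intro i hi hne
      simp only [Finset.mem_filter, Finset.mem_univ, true_and] at hi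
      exact absurd (by simpa using huniq s i hi) hne
    · intro h
      simp [he, M.first_right] at h
    · intro s' _ hne
      refine Finset.sum_eq_zero fun i hi => ?_
      simp only [Finset.mem_filter, Finset.mem_univ, true_and] at hi
      exact absurd (Sigma.mk.inj_iff.1 (huniq s' i hi)).1 hne
    · intro h
      simp at h
  have hsum := sum_edge_mul_ghost (R := R) (v := M.src s (M.root s)) (S := {e})
    (Finset.singleton_nonempty e) fun f => by
      rw [Finset.mem_singleton]
      exact ⟨fun h => by rw [h, he, M.first_left], fun h => M.eq_first_root s f h⟩
  rw [Finset.sum_singleton] at hsum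
  calc M.cyc R s * M.ghostCyc R s
      = leavittEdge R e * (M.mono R s (M.tail s (M.root s)) *
          M.ghostMono R s (M.tail s (M.root s))) * leavittGhost R e := by
        simp only [cyc, ghostCyc, mul_assoc, ← he]
    _ = leavittVertex R (M.src s (M.root s)) := by
        rw [← hright, edge_mul_right, hsum]

theorem root_mul_cycPow (s : Fin t) (k : ℤ) :
    leavittVertex R (M.src s (M.root s)) * M.cycPow R s k = M.cycPow R s k :=
  mul_cornerPow_of_mul_eq (vertex_mul_vertex _) (M.root_mul_cyc s) (M.root_mul_ghostCyc s) k

theorem cyc_mul_cycPow [Finite (Total V)] (s : Fin t) (k : ℤ) :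
    M.cyc R s * M.cycPow R s k = M.cycPow R s (k + 1) :=
  mul_cornerPow (vertex_mul_vertex _) (M.root_mul_ghostCyc s) (M.cyc_mul_ghostCyc s) k

theorem src_mul_unit (s : Fin t) (i : Fin (n s)) (k : ℤ) (j : Fin (n s)) :
    leavittVertex R (M.src s i) * M.unit R s i k j = M.unit R s i k j := by
  rw [unit, ← mul_assoc, src_mul_mono]

/-- The first edge of a nontrivial path splits off without a change of the exponent. -/
theorem unit_eq_edge_mul_unit_of_ne {s : Fin t} {i : Fin (n s)} (hi : i ≠ M.root s) (k : ℤ)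
    (j : Fin (n s)) :
    M.unit R s i k j = leavittEdge R (M.first s i) * M.unit R s (M.tail s i) k j := by
  rw [unit, unit, mono_of_ne R M hi, mul_assoc]

/-- At the trivial path, splitting off the first edge of the cycle costs one power of the cycle. -/
theorem unit_root_eq_edge_mul_unit [Finite (Total V)] (s : Fin t) (k : ℤ) (j : Fin (n s)) :
    M.unit R s (M.root s) (k + 1) j =
      leavittEdge R (M.first s (M.root s)) * M.unit R s (M.tail s (M.root s)) k j := by
  rw [unit, unit, mono_root, ← mul_assoc, root_mul_cycPow, ← cyc_mul_cycPow, cyc]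
  simp only [mul_assoc]

variable (R) in
/-- The span of the elements `i Cₛᵏ j*`. -/
noncomputable def unitSpan : Submodule R (Leavitt R V) :=
  Submodule.span R (Set.range fun x : Σ s, Fin (n s) × ℤ × Fin (n s) =>
    M.unit R x.1 x.2.1 x.2.2.1 x.2.2.2)

theorem unit_mem_unitSpan (s : Fin t) (i : Fin (n s)) (k : ℤ) (j : Fin (n s)) :
    M.unit R s i k j ∈ M.unitSpan R :=
  Submodule.subset_span ⟨⟨s, i, k, j⟩, rfl⟩

/-- A generator moves an element `i Cₛᵏ j*` to zero or to another such element, which has the first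
edge of `i` removed or an edge put before `i`. -/
theorem gen_mul_unit_mem [Finite (Total V)] (g : Gen V) (s : Fin t) (i : Fin (n s)) (k : ℤ)
    (j : Fin (n s)) :
    leavittWord R (FreeSemigroup.of g) * M.unit R s i k j ∈ M.unitSpan R := by
  cases g with
  | vertex v =>
    change leavittVertex R v * _ ∈ _
    by_cases h : v = M.src s i
    · rw [h, src_mul_unit]
      exact M.unit_mem_unitSpan s i k j
    · rw [← src_mul_unit, ← mul_assoc, vertex_mul_vertex_of_ne h, zero_mul]
      exact zero_mem _
  | edge e =>
    change leavittEdge R e * _ ∈ _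
    by_cases h : e.right = M.src s i
    · by_cases hr : M.push s e i h = M.root s
      · have h' := M.unit_root_eq_edge_mul_unit (R := R) s k j
        rw [← hr, M.first_push, M.tail_push] at h'
        rw [← h']
        exact M.unit_mem_unitSpan s _ _ j
      · have h' := M.unit_eq_edge_mul_unit_of_ne (R := R) hr k j
        rw [M.first_push, M.tail_push] at h'
        rw [← h']
        exact M.unit_mem_unitSpan s _ _ j
    · rw [← src_mul_unit, ← edge_mul_right, mul_assoc, ← mul_assoc (leavittVertex R e.right),
        vertex_mul_vertex_of_ne h, zero_mul, mul_zero]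
      exact zero_mem _
  | ghost e =>
    change leavittGhost R e * _ ∈ _
    obtain ⟨k', hk⟩ : ∃ k', M.unit R s i k j =
        leavittEdge R (M.first s i) * M.unit R s (M.tail s i) k' j := by
      by_cases hi : i = M.root s
      · subst hi
        refine ⟨k - 1, ?_⟩
        rw [← unit_root_eq_edge_mul_unit, sub_add_cancel]
      · exact ⟨k, M.unit_eq_edge_mul_unit_of_ne hi k j⟩
    rw [hk, ← mul_assoc]
    by_cases h : e = M.first s i
    · rw [h, ghost_mul_edge, M.first_right, src_mul_unit]
      exact M.unit_mem_unitSpan s _ _ j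
    · rw [ghost_mul_edge_of_ne h, zero_mul]
      exact zero_mem _

theorem gen_mul_mem_unitSpan [Finite (Total V)] (g : Gen V) {a : Leavitt R V}
    (ha : a ∈ M.unitSpan R) : leavittWord R (FreeSemigroup.of g) * a ∈ M.unitSpan R := by
  induction ha using Submodule.span_induction with
  | mem a ha =>
    obtain ⟨⟨s, i, k, j⟩, rfl⟩ := ha
    exact M.gen_mul_unit_mem g s i k j
  | zero =>
    rw [mul_zero]
    exact zero_mem _
  | add a b _ _ ha hb =>
    rw [mul_add]
    exact add_mem ha hb
  | smul r a _ ha =>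
    rw [leavittWord_mul_smul]
    exact Submodule.smul_mem _ r ha

theorem unit_zero (s : Fin t) (i j : Fin (n s)) :
    M.unit R s i 0 j = M.mono R s i * M.ghostMono R s j := by
  change M.mono R s i * (leavittVertex R (M.src s (M.root s)) * M.ghostMono R s j) = _
  rw [root_mul_ghostMono]

theorem vertex_mem_unitSpan [Finite (Total V)] (v : V) : leavittVertex R v ∈ M.unitSpan R := by
  rw [M.vertex_eq_sum]
  refine sum_mem fun s _ => sum_mem fun i _ => ?_
  rw [← unit_zero]
  exact M.unit_mem_unitSpan s i 0 i

/-- A word is the product of its letters with the vertex at its end, so it lies in the span because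
the vertices do and the generators preserve the span. -/
theorem unitSpan_eq_top [Finite (Total V)] : M.unitSpan R = ⊤ := by
  rw [eq_top_iff, ← span_leavittWord, Submodule.span_le]
  rintro _ ⟨m, rfl⟩
  induction m using FreeSemigroup.recOnMul with
  | ih1 g =>
    cases g with
    | vertex v => exact M.vertex_mem_unitSpan v
    | edge e =>
      have h : leavittEdge R e * leavittVertex R e.right ∈ M.unitSpan R :=
        M.gen_mul_mem_unitSpan (Gen.edge e) (M.vertex_mem_unitSpan e.right)
      rw [edge_mul_right] at h
      exact h
    | ghost e =>
      have h : leavittGhost R e * leavittVertex R e.left ∈ M.unitSpan R :=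
        M.gen_mul_mem_unitSpan (Gen.ghost e) (M.vertex_mem_unitSpan e.left)
      rw [ghost_mul_left] at h
      exact h
  | ih2 g m _ hm =>
    rw [leavittWord_mul]
    exact M.gen_mul_mem_unitSpan g hm

end

end PathModel

/-! ### The isomorphism with the sum of matrix rings -/

theorem exists_zsmul_unitExp {l : ℕ} (hl : 0 < l) (z : AddSubgroup.zmultiples (l : ℤ)) :
    ((z : ℤ) / l) • PathModel.unitExp l = z := by
  obtain ⟨z, hz⟩ := z
  obtain ⟨k, rfl⟩ := AddSubgroup.mem_zmultiples_iff.1 hz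
  refine Subtype.ext ?_
  have : (l : ℤ) ≠ 0 := by positivity
  simp [PathModel.unitExp, Int.mul_ediv_cancel _ this]

theorem mul_piSingle {t : ℕ} {B : Fin t → Type*} [∀ s, NonUnitalNonAssocSemiring (B s)]
    (A : ∀ s, B s) (s : Fin t) (X : B s) : A * Pi.single s X = Pi.single s (A s * X) := by
  funext s'
  by_cases h : s' = s
  · subst h
    simp
  · simp [Pi.single_eq_of_ne h]

theorem piSingle_mul {t : ℕ} {B : Fin t → Type*} [∀ s, NonUnitalNonAssocSemiring (B s)]
    (A : ∀ s, B s) (s : Fin t) (X : B s) : Pi.single s X * A = Pi.single s (X * A s) := by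
  funext s'
  by_cases h : s' = s
  · subst h
    simp
  · simp [Pi.single_eq_of_ne h]

namespace PathModel

open scoped Classical in
section

universe u w x

variable {R : Type x} [Ring R] {V : Type u} [Quiver.{w} V] {t : ℕ} {l n : Fin t → ℕ}
  (M : PathModel V l n)

theorem genMat_root (s : Fin t) :
    M.genMat R (Gen.vertex (M.src s (M.root s))) = matUnit R s (M.root s) (M.root s) 0 := by
  funext s'
  ext1 i j
  by_cases h : M.src s' i = M.src s (M.root s)
  · obtain ⟨rfl, h'⟩ := Sigma.mk.inj_iff.1 (M.src_eq_src_root s s' i h)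
    obtain rfl := eq_of_heq h'
    rw [genMat, rowMat_some (by rw [act_vertex, if_pos rfl]), matUnit, Pi.single_eq_same,
      Matrix.single_apply]
    simp [eq_comm]
  · rw [genMat, rowMat_none (by rw [act_vertex, if_neg h]), matUnit]
    by_cases hs : s' = s
    · subst hs
      rw [Pi.single_eq_same, Matrix.single_apply_of_row_ne]
      rintro rfl
      exact h rfl
    · rw [Pi.single_eq_of_ne hs]
      rfl

theorem genMat_edge_mul_matUnit (s : Fin t) (i k : Fin (n s))
    (z : AddSubgroup.zmultiples (l s : ℤ)) :
    M.genMat R (Gen.edge (M.first s i)) * matUnit R s (M.tail s i) k z =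
      matUnit R s i k (M.turn s i + z) := by
  rw [matUnit, mul_piSingle, genMat, rowMat_mul_single (i := i) (a := M.turn s i),
    AddMonoidAlgebra.single_mul_single, one_mul, matUnit]
  · rw [act_edge, if_pos rfl]
  · intro i' a' h
    rw [act_edge] at h
    split_ifs at h with hf
    simp only [Option.some.injEq, Prod.mk.injEq] at h
    exact M.ext s i' i hf h.1

theorem matUnit_mul_genMat_ghost (s : Fin t) (i k : Fin (n s))
    (z : AddSubgroup.zmultiples (l s : ℤ)) :
    matUnit R s k (M.tail s i) z * M.genMat R (Gen.ghost (M.first s i)) =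
      matUnit R s k i (z - M.turn s i) := by
  rw [matUnit, piSingle_mul, genMat, single_mul_rowMat (k := i) (a := - M.turn s i),
    AddMonoidAlgebra.single_mul_single, one_mul, matUnit, sub_eq_add_neg]
  rw [M.act_ghost_some (M.first_right s i), M.push_eq (M.first_right s i) rfl rfl]

theorem turn_of_ne {s : Fin t} {i : Fin (n s)} (h : i ≠ M.root s) : M.turn s i = 0 := if_neg h

theorem turn_root (s : Fin t) : M.turn s (M.root s) = unitExp (l s) := if_pos rfl

variable {φ : Leavitt R V →ₗ[R] MatSum R l n} (hmul : ∀ a b, φ (a * b) = φ a * φ b)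
  (hword : ∀ m, φ (leavittWord R m) = FreeSemigroup.lift (M.genMat R) m)

include hmul hword

theorem map_mono (s : Fin t) (i : Fin (n s)) :
    φ (M.mono R s i) = matUnit R s i (M.root s) 0 := by
  induction i using M.tail_induction with
  | hroot => rw [mono_root, leavittVertex, hword, FreeSemigroup.lift_of, genMat_root]
  | htail i hi ih =>
    rw [mono_of_ne R M hi, hmul, ih, leavittEdge, hword, FreeSemigroup.lift_of,
      genMat_edge_mul_matUnit, M.turn_of_ne hi, add_zero]

theorem map_ghostMono (s : Fin t) (i : Fin (n s)) :
    φ (M.ghostMono R s i) = matUnit R s (M.root s) i 0 := by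
  induction i using M.tail_induction with
  | hroot => rw [ghostMono_root, leavittVertex, hword, FreeSemigroup.lift_of, genMat_root]
  | htail i hi ih =>
    rw [ghostMono_of_ne R M hi, hmul, ih, leavittGhost, hword, FreeSemigroup.lift_of,
      matUnit_mul_genMat_ghost, M.turn_of_ne hi, sub_zero]

theorem map_cycPow (s : Fin t) (k : ℤ) :
    φ (M.cycPow R s k) = matUnit R s (M.root s) (M.root s) (k • unitExp (l s)) := by
  have hcyc : φ (M.cyc R s) = matUnit R s (M.root s) (M.root s) (unitExp (l s)) := by
    rw [cyc, hmul, M.map_mono hmul hword, leavittEdge, hword, FreeSemigroup.lift_of,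
      genMat_edge_mul_matUnit, turn_root, add_zero]
  have hghost : φ (M.ghostCyc R s) = matUnit R s (M.root s) (M.root s) (-unitExp (l s)) := by
    rw [ghostCyc, hmul, M.map_ghostMono hmul hword, leavittGhost, hword, FreeSemigroup.lift_of,
      matUnit_mul_genMat_ghost, turn_root, zero_sub]
  have hvertex : φ (leavittVertex R (M.src s (M.root s))) =
      matUnit R s (M.root s) (M.root s) 0 := by
    rw [leavittVertex, hword, FreeSemigroup.lift_of, genMat_root]
  have hnat (a : Leavitt R V) (z : AddSubgroup.zmultiples (l s : ℤ))
      (ha : φ a = matUnit R s (M.root s) (M.root s) z) (k : ℕ) :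
      φ (cornerPowNat (leavittVertex R (M.src s (M.root s))) a k) =
        matUnit R s (M.root s) (M.root s) (k • z) := by
    induction k with
    | zero => rw [cornerPowNat, hvertex, zero_smul]
    | succ k ih => rw [cornerPowNat, hmul, ha, ih, matUnit_mul_matUnit, succ_nsmul']
  rcases k with k | k
  · rw [cycPow, cornerPow, hnat _ _ hcyc, Int.ofNat_eq_natCast, natCast_zsmul]
  · rw [cycPow, cornerPow, hnat _ _ hghost, negSucc_zsmul, smul_neg]

theorem map_unit (s : Fin t) (i : Fin (n s)) (k : ℤ) (j : Fin (n s)) :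
    φ (M.unit R s i k j) = matUnit R s i j (k • unitExp (l s)) := by
  rw [unit, hmul, hmul, M.map_mono hmul hword, M.map_ghostMono hmul hword,
    M.map_cycPow hmul hword, matUnit_mul_matUnit, matUnit_mul_matUnit, zero_add, add_zero]

omit hmul hword

variable (R) in
/-- The linear map that sends `xᶻ Eᵢⱼ` to `i Cₛᵏ j*`, where `z = k lₛ`. -/
noncomputable def matToLeavitt : MatSum R l n →ₗ[R] Leavitt R V where
  toFun A := ∑ s, ∑ i, ∑ j, Finsupp.linearCombination R
    (fun z : AddSubgroup.zmultiples (l s : ℤ) => M.unit R s i ((z : ℤ) / l s) j) (A s i j).coeff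
  map_add' A B := by
    simp only [Pi.add_apply, Matrix.add_apply, AddMonoidAlgebra.coeff_add, map_add,
      Finset.sum_add_distrib]
  map_smul' r A := by
    simp only [Pi.smul_apply, Matrix.smul_apply, AddMonoidAlgebra.coeff_smul, map_smul,
      Finset.smul_sum, RingHom.id_apply]

theorem matToLeavitt_apply (A : MatSum R l n) :
    M.matToLeavitt R A = ∑ s, ∑ i, ∑ j, Finsupp.linearCombination R
      (fun z : AddSubgroup.zmultiples (l s : ℤ) => M.unit R s i ((z : ℤ) / l s) j)
      (A s i j).coeff := rfl

theorem matToLeavitt_matUnit (s : Fin t) (i j : Fin (n s))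
    (z : AddSubgroup.zmultiples (l s : ℤ)) :
    M.matToLeavitt R (matUnit R s i j z) = M.unit R s i ((z : ℤ) / l s) j := by
  rw [matToLeavitt_apply, Finset.sum_eq_single s, Finset.sum_eq_single i,
    Finset.sum_eq_single j]
  · simp [matUnit]
  · intro j' _ hj
    simp [matUnit, Matrix.single_apply_of_col_ne _ _ (Ne.symm hj)]
  · simp
  · intro i' _ hi
    simp [matUnit, Matrix.single_apply_of_row_ne (Ne.symm hi)]
  · simp
  · intro s' _ hs
    simp [matUnit, Pi.single_eq_of_ne hs]
  · simp

theorem len_pos (M : PathModel V l n) (s : Fin t) : 0 < l s := by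
  rw [M.deg_tail_root]
  lia

theorem isWordOfDegree_mono (s : Fin t) (i : Fin (n s)) :
    IsWordOfDegree R (M.deg s i) (M.mono R s i) := by
  induction i using M.tail_induction with
  | hroot =>
    rw [mono_root, M.deg_root]
    exact isWordOfDegree_vertex _
  | htail i hi ih =>
    rw [mono_of_ne R M hi, M.deg_tail s i hi, Nat.cast_add, Nat.cast_one, add_comm]
    exact (isWordOfDegree_edge _).mul ih

theorem isWordOfDegree_ghostMono (s : Fin t) (i : Fin (n s)) :
    IsWordOfDegree R (-(M.deg s i : ℤ)) (M.ghostMono R s i) := by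
  induction i using M.tail_induction with
  | hroot =>
    rw [ghostMono_root, M.deg_root]
    exact isWordOfDegree_vertex _
  | htail i hi ih =>
    rw [ghostMono_of_ne R M hi, M.deg_tail s i hi, Nat.cast_add, Nat.cast_one, neg_add]
    exact ih.mul (isWordOfDegree_ghost _)

theorem isWordOfDegree_cycPow (s : Fin t) (k : ℤ) :
    IsWordOfDegree R (k * l s) (M.cycPow R s k) := by
  have hnat (a : Leavitt R V) (d : ℤ) (ha : IsWordOfDegree R d a) (k : ℕ) :
      IsWordOfDegree R (k * d) (cornerPowNat (leavittVertex R (M.src s (M.root s))) a k) := by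
    induction k with
    | zero =>
      rw [Nat.cast_zero, zero_mul]
      exact isWordOfDegree_vertex _
    | succ k ih =>
      rw [Nat.cast_succ, add_one_mul, add_comm]
      exact ha.mul ih
  have hcyc : IsWordOfDegree R (l s) (M.cyc R s) := by
    rw [M.deg_tail_root, Nat.cast_add, Nat.cast_one, add_comm]
    exact (isWordOfDegree_edge _).mul (M.isWordOfDegree_mono s _)
  have hghost : IsWordOfDegree R (-l s) (M.ghostCyc R s) := by
    rw [M.deg_tail_root, Nat.cast_add, Nat.cast_one, neg_add]
    exact (M.isWordOfDegree_ghostMono s _).mul (isWordOfDegree_ghost _)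
  rcases k with k | k
  · exact hnat _ _ hcyc k
  · have h := hnat _ _ hghost (k + 1)
    rw [mul_neg, ← neg_mul] at h
    exact h

theorem isWordOfDegree_unit (s : Fin t) (i : Fin (n s)) (k : ℤ) (j : Fin (n s)) :
    IsWordOfDegree R (k * l s + M.deg s i - M.deg s j) (M.unit R s i k j) := by
  have h := (M.isWordOfDegree_mono (R := R) s i).mul
    ((M.isWordOfDegree_cycPow (R := R) s k).mul (M.isWordOfDegree_ghostMono (R := R) s j))
  rwa [show (M.deg s i : ℤ) + (k * l s + -(M.deg s j : ℤ)) =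
    k * l s + M.deg s i - M.deg s j by ring] at h

theorem matToLeavitt_mem_grading {k : ℤ} {A : MatSum R l n}
    (hA : A ∈ matSumGrading R l n (fun s i => (M.deg s i : ℤ)) k) :
    M.matToLeavitt R A ∈ Leavitt.grading R V k := by
  rw [mem_matSumGrading] at hA
  rw [matToLeavitt_apply]
  refine sum_mem fun s _ => sum_mem fun i _ => sum_mem fun j _ => ?_
  rw [Finsupp.linearCombination_apply]
  refine sum_mem fun z hz => Submodule.smul_mem _ _ ?_
  have h : (z : ℤ) = k + M.deg s j - M.deg s i := hA s i j z (Finsupp.mem_support_iff.1 hz)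
  have h' : (z : ℤ) / l s * l s = z :=
    Int.ediv_mul_cancel (Int.mem_zmultiples_iff.1 z.2)
  have h'' := (M.isWordOfDegree_unit (R := R) s i ((z : ℤ) / l s) j).mem_grading
  rwa [show (z : ℤ) / l s * l s + M.deg s i - M.deg s j = k by rw [h', h]; ring] at h''

/-- The elements `i Cₛᵏ j*` span the Leavitt path algebra and are mapped to the basis of the
matrix units `xᶻ Eᵢⱼ`, hence the representation by matrices is an isomorphism. -/
theorem gradedAlgIso [Finite (Total V)] :
    GradedAlgIso (Leavitt.grading R V)
      (matSumGrading R l n fun s i => (M.deg s i : ℤ)) := by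
  obtain ⟨φ, hmul, hword⟩ := M.exists_leavitt_hom (R := R)
  have h₁ : M.matToLeavitt R ∘ₗ φ = LinearMap.id := by
    refine LinearMap.ext_on_range (M.unitSpan_eq_top (R := R)) ?_
    rintro ⟨s, i, k, j⟩
    have hl : (l s : ℤ) ≠ 0 := by
      have := M.len_pos s
      positivity
    rw [LinearMap.comp_apply, M.map_unit hmul hword, matToLeavitt_matUnit, LinearMap.id_apply]
    congr 1
    simp [unitExp, Int.mul_ediv_cancel _ hl]
  have h₂ : φ ∘ₗ M.matToLeavitt R = LinearMap.id := by
    refine LinearMap.ext_on_range (span_matUnit l n) ?_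
    rintro ⟨s, i, j, z⟩
    rw [LinearMap.comp_apply, matToLeavitt_matUnit, M.map_unit hmul hword,
      exists_zsmul_unitExp (M.len_pos s), LinearMap.id_apply]
  refine ⟨
    { toFun := φ
      invFun := M.matToLeavitt R
      left_inv := LinearMap.congr_fun h₁
      right_inv := LinearMap.congr_fun h₂
      map_mul' := hmul
      map_add' := map_add φ }, fun r a => map_smul φ r a, fun k a => ⟨fun h => ?_, fun h => ?_⟩⟩
  · rw [← LinearMap.id_apply (R := R) a, ← h₁]
    exact M.matToLeavitt_mem_grading h
  · change φ a ∈ _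
    induction h using Submodule.span_induction with
    | mem a ha =>
      obtain ⟨m, rfl, rfl⟩ := ha
      change φ (leavittWord R m) ∈ _
      rw [hword]
      exact M.lift_genMat_mem_grading m
    | zero =>
      rw [map_zero]
      exact zero_mem _
    | add a b _ _ ha hb =>
      rw [map_add]
      exact add_mem ha hb
    | smul r a _ ha =>
      rw [map_smul]
      exact Submodule.smul_mem _ r ha

end

end PathModel

/-- The Leavitt path algebra of a comet is a direct sum of matrix rings over Laurent polynomials,
graded by the path lengths. -/
theorem leavitt_gradedAlgIso_matSum (R : Type*) [Ring R] {V : Type*} [Quiver V]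
    (hV : IsMultiHeadedComet V) {t : ℕ} (C : CycleChoice V t) (p : C.PathEnum) :
    GradedAlgIso (Leavitt.grading R V)
      (matSumGrading R C.len C.n (CycleChoice.pathLengths p)) := by
  have := hV.finite_edges
  obtain ⟨M, hM⟩ := C.exists_pathModel hV p
  have h := M.gradedAlgIso (R := R)
  rwa [show (fun s i => (M.deg s i : ℤ)) = CycleChoice.pathLengths p from
    funext fun s => funext fun i => hM s i] at h

/-! ### Graded isomorphisms between sums of matrix rings -/

section GradedIso

variable {R A B D : Type*} [Ring R] [NonUnitalRing A] [Module R A] [NonUnitalRing B] [Module R B]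
  [NonUnitalRing D] [Module R D] {𝒜 : ℤ → Submodule R A} {ℬ : ℤ → Submodule R B}
  {𝒟 : ℤ → Submodule R D}

theorem GradedRingIso.trans (h : GradedRingIso 𝒜 ℬ) (h' : GradedRingIso ℬ 𝒟) :
    GradedRingIso 𝒜 𝒟 := by
  obtain ⟨φ, hφ⟩ := h
  obtain ⟨ψ, hψ⟩ := h'
  exact ⟨φ.trans ψ, fun k a => (hψ k _).trans (hφ k a)⟩

theorem GradedAlgIso.gradedRingIso (h : GradedAlgIso 𝒜 ℬ) : GradedRingIso 𝒜 ℬ := by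
  obtain ⟨φ, -, hφ⟩ := h
  exact ⟨φ, hφ⟩

theorem GradedAlgIso.symm (h : GradedAlgIso 𝒜 ℬ) : GradedAlgIso ℬ 𝒜 := by
  obtain ⟨φ, hφ, hφ'⟩ := h
  refine ⟨φ.symm, fun r b => ?_, fun k b => by rw [← hφ', RingEquiv.apply_symm_apply]⟩
  apply φ.injective
  rw [hφ, RingEquiv.apply_symm_apply, RingEquiv.apply_symm_apply]

theorem GradedAlgIso.trans (h : GradedAlgIso 𝒜 ℬ) (h' : GradedAlgIso ℬ 𝒟) :
    GradedAlgIso 𝒜 𝒟 := by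
  obtain ⟨φ, hφ, hφ'⟩ := h
  obtain ⟨ψ, hψ, hψ'⟩ := h'
  refine ⟨φ.trans ψ, fun r a => ?_, fun k a => (hψ' k _).trans (hφ' k a)⟩
  rw [RingEquiv.trans_apply, hφ, hψ, RingEquiv.trans_apply]

end GradedIso

section Blocks

universe x

variable (R : Type x) [Ring R]

theorem LaurentPow.single_mul_mul_single_mem_grading {l : ℕ} {k : ℤ} {f : LaurentPow R l}
    (hf : f ∈ LaurentPow.grading R l k) (y z : AddSubgroup.zmultiples (l : ℤ)) :
    AddMonoidAlgebra.single y 1 * f * AddMonoidAlgebra.single z 1 ∈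
      LaurentPow.grading R l (y + k + z) :=
  LaurentPow.mul_mem_grading (LaurentPow.mul_mem_grading (LaurentPow.single_mem_grading y 1) hf)
    (LaurentPow.single_mem_grading z 1)

theorem single_mul_smul_mul_single {l : ℕ} (r : R) (f : LaurentPow R l)
    (y z : AddSubgroup.zmultiples (l : ℤ)) :
    AddMonoidAlgebra.single y 1 * r • f * AddMonoidAlgebra.single z 1 =
      r • (AddMonoidAlgebra.single y 1 * f * AddMonoidAlgebra.single z 1) := by
  induction f using AddMonoidAlgebra.induction_linear with
  | zero => simp
  | add f g hf hg => rw [smul_add, mul_add, mul_add, add_mul, add_mul, hf, hg, smul_add]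
  | single w r' =>
    simp [AddMonoidAlgebra.smul_single, AddMonoidAlgebra.single_mul_single]

/-- The isomorphism between two matrix rings with related degrees is a permutation of the indices
followed by the conjugation with a diagonal matrix of monomials. -/
theorem exists_block_equiv {l l' n m : ℕ} (hl : l = l') {δ : Fin n → ℤ} {γ : Fin m → ℤ}
    (h : ShiftRelated l δ γ) :
    ∃ θ : Matrix (Fin n) (Fin n) (LaurentPow R l) ≃+* Matrix (Fin m) (Fin m) (LaurentPow R l'),
      (∀ (r : R) A, θ (r • A) = r • θ A) ∧
        ∀ k A, θ A ∈ matGrading R l' γ k ↔ A ∈ matGrading R l δ k := by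
  subst hl
  obtain ⟨π, σ, h⟩ := h
  choose τ hτ h using h
  let y (i : Fin n) : AddSubgroup.zmultiples (l : ℤ) := ⟨τ i, hτ i⟩
  let x (z : AddSubgroup.zmultiples (l : ℤ)) : LaurentPow R l := AddMonoidAlgebra.single z 1
  have hx (z z' : AddSubgroup.zmultiples (l : ℤ)) : x z * x z' = x (z + z') := by
    simp [x, AddMonoidAlgebra.single_mul_single]
  have hx0 : x 0 = 1 := rfl
  have h₁ : Matrix.diagonal (fun i => x (y i)) * Matrix.diagonal (fun i => x (-y i)) = 1 := by
    simp [Matrix.diagonal_mul_diagonal, hx, hx0]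
  have h₂ : Matrix.diagonal (fun i => x (-y i)) * Matrix.diagonal (fun i => x (y i)) = 1 := by
    simp [Matrix.diagonal_mul_diagonal, hx, hx0]
  let conj : Matrix (Fin n) (Fin n) (LaurentPow R l) ≃+* Matrix (Fin n) (Fin n) (LaurentPow R l) :=
    { toFun := fun A => Matrix.diagonal (fun i => x (y i)) * A * Matrix.diagonal fun i => x (-y i)
      invFun := fun A => Matrix.diagonal (fun i => x (-y i)) * A * Matrix.diagonal fun i => x (y i)
      left_inv := fun A => by
        simp only [← mul_assoc, h₂, one_mul]
        rw [mul_assoc, h₂, mul_one]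
      right_inv := fun A => by
        simp only [← mul_assoc, h₁, one_mul]
        rw [mul_assoc, h₁, mul_one]
      map_mul' := fun A B => by
        calc _ = Matrix.diagonal (fun i => x (y i)) * A * 1 * B *
              Matrix.diagonal fun i => x (-y i) := by simp only [mul_assoc, mul_one]
          _ = _ := by rw [← h₂]; simp only [mul_assoc]
      map_add' := fun A B => by rw [mul_add, add_mul] }
  let re : Matrix (Fin n) (Fin n) (LaurentPow R l) ≃+* Matrix (Fin m) (Fin m) (LaurentPow R l) :=
    { Matrix.reindex π π with
      map_mul' := fun A B => (Matrix.submatrix_mul_equiv A B _ π.symm _).symm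
      map_add' := fun A B => rfl }
  have hentry (A : Matrix (Fin n) (Fin n) (LaurentPow R l)) (i j : Fin m) :
      (conj.trans re) A i j = x (y (π.symm i)) * A (π.symm i) (π.symm j) * x (-y (π.symm j)) := by
    change (Matrix.diagonal (fun i => x (y i)) * A * Matrix.diagonal fun i => x (-y i))
      (π.symm i) (π.symm j) = _
    rw [Matrix.mul_diagonal, Matrix.diagonal_mul]
  refine ⟨conj.trans re, fun r A => ?_, fun k A => ⟨fun hA i j => ?_, fun hA i j => ?_⟩⟩
  · ext1 i j
    rw [hentry, Matrix.smul_apply, Matrix.smul_apply, hentry, single_mul_smul_mul_single]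
  · have hij := LaurentPow.single_mul_mul_single_mem_grading R (hA (π i) (π j)) (-y i) (y j)
    rw [hentry, Equiv.symm_apply_apply, Equiv.symm_apply_apply] at hij
    have hA' : x (-y i) * (x (y i) * A i j * x (-y j)) * x (y j) = A i j := by
      calc x (-y i) * (x (y i) * A i j * x (-y j)) * x (y j)
          = (x (-y i) * x (y i)) * A i j * (x (-y j) * x (y j)) := by simp only [mul_assoc]
        _ = A i j := by rw [hx, hx, neg_add_cancel, neg_add_cancel, hx0, one_mul, mul_one]
    have hd : ((-y i : AddSubgroup.zmultiples (l : ℤ)) : ℤ) + (k + γ (π j) - γ (π i)) + y j =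
        k + δ j - δ i := by
      rw [h i, h j]
      simp only [NegMemClass.coe_neg, y]
      ring
    rwa [hd, hA'] at hij
  · rw [hentry]
    have hij := LaurentPow.single_mul_mul_single_mem_grading R (hA (π.symm i) (π.symm j))
      (y (π.symm i)) (-y (π.symm j))
    have hd : (y (π.symm i) : ℤ) + (k + δ (π.symm j) - δ (π.symm i)) +
        (-y (π.symm j) : AddSubgroup.zmultiples (l : ℤ)) = k + γ j - γ i := by
      rw [h, h, Equiv.apply_symm_apply, Equiv.apply_symm_apply]
      simp only [NegMemClass.coe_neg, y]
      ring
    rwa [hd] at hij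

/-- Sums of matrix rings whose blocks correspond under a permutation are isomorphic. -/
theorem gradedAlgIso_matSum_of_shiftRelated {t t' : ℕ} {l n : Fin t → ℕ} {l' m : Fin t' → ℕ}
    {δ : ∀ s, Fin (n s) → ℤ} {γ : ∀ s, Fin (m s) → ℤ} (π : Fin t ≃ Fin t')
    (h : ∀ s, l s = l' (π s) ∧ ShiftRelated (l s) (δ s) (γ (π s))) :
    GradedAlgIso (matSumGrading R l n δ) (matSumGrading R l' m γ) := by
  have hθ (s' : Fin t') : ∃ θ : Matrix (Fin (n (π.symm s'))) (Fin (n (π.symm s')))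
      (LaurentPow R (l (π.symm s'))) ≃+* Matrix (Fin (m s')) (Fin (m s')) (LaurentPow R (l' s')),
      (∀ (r : R) A, θ (r • A) = r • θ A) ∧ ∀ k A, θ A ∈ matGrading R (l' s') (γ s') k ↔
        A ∈ matGrading R (l (π.symm s')) (δ (π.symm s')) k := by
    obtain ⟨s, rfl⟩ := π.surjective s'
    rw [Equiv.symm_apply_apply]
    exact exists_block_equiv R (h s).1 (h s).2
  choose θ hsmul hgr using hθ
  refine ⟨(RingEquiv.piCongrLeft' (fun s => Matrix (Fin (n s)) (Fin (n s)) (LaurentPow R (l s)))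
    π).trans (RingEquiv.piCongrRight θ), fun r A => funext fun s' => hsmul s' r _, fun k A => ?_⟩
  constructor
  · intro hA s _
    obtain ⟨s', rfl⟩ := π.symm.surjective s
    exact (hgr s' k _).1 (hA s' (Set.mem_univ s'))
  · intro hA s' _
    exact (hgr s' k _).2 (hA _ (Set.mem_univ _))

end Blocks

/-! ### Homogeneous equivalence of idempotents -/

section HomogEquiv

variable {R A B : Type*} [Ring R] [NonUnitalRing A] [Module R A] [NonUnitalRing B] [Module R B]

/-- The idempotents `x` and `y` are equivalent by homogeneous elements of degrees `k` and `-k`.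
In a graded ring this says that the graded modules generated by `x` and `y` are isomorphic up to a
shift by `k`. -/
def HomogEquiv (𝒜 : ℤ → Submodule R A) (k : ℤ) (x y : A) : Prop :=
  ∃ u ∈ 𝒜 k, ∃ v ∈ 𝒜 (-k), u * v = x ∧ v * u = y ∧ x * u = u ∧ u * y = u ∧ y * v = v ∧ v * x = v

variable {𝒜 : ℤ → Submodule R A} {ℬ : ℤ → Submodule R B}

theorem HomogEquiv.symm {k : ℤ} {x y : A} (h : HomogEquiv 𝒜 k x y) : HomogEquiv 𝒜 (-k) y x := by
  obtain ⟨u, hu, v, hv, h₁, h₂, h₃, h₄, h₅, h₆⟩ := h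
  exact ⟨v, hv, u, by rwa [neg_neg], h₂, h₁, h₅, h₆, h₃, h₄⟩

theorem HomogEquiv.trans
    (hmul : ∀ {k k' : ℤ} {a b : A}, a ∈ 𝒜 k → b ∈ 𝒜 k' → a * b ∈ 𝒜 (k + k')) {k k' : ℤ}
    {x y z : A} (h : HomogEquiv 𝒜 k x y) (h' : HomogEquiv 𝒜 k' y z) :
    HomogEquiv 𝒜 (k + k') x z := by
  obtain ⟨u, hu, v, hv, h₁, h₂, h₃, h₄, h₅, h₆⟩ := h
  obtain ⟨u', hu', v', hv', h₁', h₂', h₃', h₄', h₅', h₆'⟩ := h'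
  refine ⟨u * u', hmul hu hu', v' * v, ?_, ?_, ?_, ?_, ?_, ?_, ?_⟩
  · rw [neg_add_rev]
    exact hmul hv' hv
  · calc u * u' * (v' * v) = u * (u' * v') * v := by simp only [mul_assoc]
      _ = x := by rw [h₁', h₄, h₁]
  · calc v' * v * (u * u') = v' * (v * u) * u' := by simp only [mul_assoc]
      _ = z := by rw [h₂, h₆', h₂']
  · rw [← mul_assoc, h₃]
  · rw [mul_assoc, h₄']
  · rw [← mul_assoc, h₅']
  · rw [mul_assoc, h₆]

theorem HomogEquiv.map {φ : A ≃+* B} (hφ : ∀ k a, φ a ∈ ℬ k ↔ a ∈ 𝒜 k) {k : ℤ} {x y : A}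
    (h : HomogEquiv 𝒜 k x y) : HomogEquiv ℬ k (φ x) (φ y) := by
  obtain ⟨u, hu, v, hv, h₁, h₂, h₃, h₄, h₅, h₆⟩ := h
  refine ⟨φ u, (hφ k u).2 hu, φ v, (hφ (-k) v).2 hv, ?_⟩
  simp only [← map_mul, h₁, h₂, h₃, h₄, h₅, h₆, and_self]

theorem homogEquiv_map_iff {φ : A ≃+* B} (hφ : ∀ k a, φ a ∈ ℬ k ↔ a ∈ 𝒜 k) {k : ℤ} {x y : A} :
    HomogEquiv ℬ k (φ x) (φ y) ↔ HomogEquiv 𝒜 k x y := by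
  refine ⟨fun h => ?_, HomogEquiv.map hφ⟩
  have h' := HomogEquiv.map (φ := φ.symm) (ℬ := 𝒜)
    (fun k b => by rw [← hφ, RingEquiv.apply_symm_apply]) h
  rwa [RingEquiv.symm_apply_apply, RingEquiv.symm_apply_apply] at h'

variable (𝒜) in
/-- An element `f` of degree `0` such that the corner `f A₀ f` contains no idempotents besides `0`
and `f`. -/
def IsPrimitiveOfDegreeZero (f : A) : Prop :=
  f ∈ 𝒜 0 ∧ ∀ x ∈ 𝒜 0, f * x = x → x * f = x → x * x = x → x = 0 ∨ x = f

theorem IsPrimitiveOfDegreeZero.map {φ : A ≃+* B} (hφ : ∀ k a, φ a ∈ ℬ k ↔ a ∈ 𝒜 k) {f : A}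
    (hf : IsPrimitiveOfDegreeZero 𝒜 f) : IsPrimitiveOfDegreeZero ℬ (φ f) := by
  refine ⟨(hφ 0 f).2 hf.1, fun x hx h₁ h₂ h₃ => ?_⟩
  obtain ⟨x, rfl⟩ := φ.surjective x
  rw [← map_mul] at h₁ h₂ h₃
  rcases hf.2 x ((hφ 0 x).1 hx) (φ.injective h₁) (φ.injective h₂) (φ.injective h₃) with rfl | rfl
  · exact Or.inl (map_zero φ)
  · exact Or.inr rfl

end HomogEquiv

section MatrixIdempotents

variable {R A : Type*} [DivisionRing R] [Ring A] [Module R A]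

/-- The properties of a diagonal matrix unit `e` in a sum of graded matrix rings over Laurent
polynomials over a division ring: it commutes with the coefficients, every nonzero row of degree
`0` can be multiplied to `e`, and the corner `e A₀ e` consists of the multiples of `e`. -/
structure IsMatrixIdempotent (𝒜 : ℤ → Submodule R A) (e : A) : Prop where
  mem : e ∈ 𝒜 0
  mul_self : e * e = e
  mul_smul : ∀ (r : R) (a : A), e * r • a = r • (e * a)
  exists_mul_eq : ∀ a ∈ 𝒜 0, e * a = a → a ≠ 0 → ∃ b ∈ 𝒜 0, a * b = e ∧ b * e = b
  exists_eq_smul : ∀ a ∈ 𝒜 0, e * a = a → a * e = a → ∃ r : R, a = r • e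
  ne_zero : e ≠ 0

namespace IsMatrixIdempotent

variable {𝒜 : ℤ → Submodule R A}
  (hmul : ∀ {k k' : ℤ} {a b : A}, a ∈ 𝒜 k → b ∈ 𝒜 k' → a * b ∈ 𝒜 (k + k')) {e : A}

theorem eq_zero_of_smul_eq_zero (he : IsMatrixIdempotent 𝒜 e) {r : R} (h : r • e = 0) : r = 0 :=
  (smul_eq_zero.1 h).resolve_right he.ne_zero

theorem isPrimitiveOfDegreeZero [IsScalarTower R A A] (he : IsMatrixIdempotent 𝒜 e) :
    IsPrimitiveOfDegreeZero 𝒜 e := by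
  refine ⟨he.mem, fun a ha h₁ h₂ h₃ => ?_⟩
  obtain ⟨r, rfl⟩ := he.exists_eq_smul a ha h₁ h₂
  rw [smul_mul_assoc, h₁, smul_smul, ← sub_eq_zero, ← sub_smul] at h₃
  have h : r * (r - 1) = 0 := by
    rw [mul_sub, mul_one]
    exact he.eq_zero_of_smul_eq_zero h₃
  rcases mul_eq_zero.1 h with h | h
  · exact Or.inl (by rw [h, zero_smul])
  · exact Or.inr (by rw [sub_eq_zero.1 h, one_smul])

/-- The elements of degree `0` that are supported in the row of `e`. -/
def rowSpace (he : IsMatrixIdempotent 𝒜 e) : Submodule R A where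
  carrier := {a | a ∈ 𝒜 0 ∧ e * a = a}
  add_mem' ha hb := ⟨add_mem ha.1 hb.1, by rw [mul_add, ha.2, hb.2]⟩
  zero_mem' := ⟨zero_mem _, mul_zero e⟩
  smul_mem' r a ha := ⟨Submodule.smul_mem _ r ha.1, by rw [he.mul_smul, ha.2]⟩

include hmul

/-- A nonzero homogeneous map from the module of a primitive idempotent to that of a diagonal matrix
unit is an isomorphism. -/
theorem homogEquiv_of_mul_ne_zero (he : IsMatrixIdempotent 𝒜 e) {f a : A}
    (hf : IsPrimitiveOfDegreeZero 𝒜 f) (hff : f * f = f) (ha : a ∈ 𝒜 0) (hea : e * a = a)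
    (h0 : a * f ≠ 0) : HomogEquiv 𝒜 0 e f := by
  have hmul₀ {x y : A} (hx : x ∈ 𝒜 0) (hy : y ∈ 𝒜 0) : x * y ∈ 𝒜 0 := hmul hx hy
  have heaf : e * (a * f) = a * f := by rw [← mul_assoc, hea]
  obtain ⟨b, hb, hab, hbe⟩ := he.exists_mul_eq (a * f) (hmul₀ ha hf.1) heaf h0
  have huv : a * f * (f * b) = e := by
    rw [← mul_assoc, mul_assoc a, hff, hab]
  -- This is a nonzero idempotent in the corner of the primitive idempotent `f`.
  have hvu : f * b * (a * f) = f := by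
    refine (hf.2 (f * b * (a * f)) (hmul₀ (hmul₀ hf.1 hb) (hmul₀ ha hf.1)) ?_ ?_ ?_).resolve_left ?_
    · simp only [← mul_assoc, hff]
    · simp only [mul_assoc, hff]
    · calc f * b * (a * f) * (f * b * (a * f))
          = f * b * (a * f * (f * b)) * (a * f) := by simp only [mul_assoc]
        _ = f * b * (a * f) := by rw [huv, mul_assoc (f * b), heaf]
    · intro h
      refine h0 ?_
      rw [← heaf, ← huv, mul_assoc, h, mul_zero]
  exact ⟨a * f, hmul₀ ha hf.1, f * b, by rw [neg_zero]; exact hmul₀ hf.1 hb, huv, hvu, heaf,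
    by rw [mul_assoc, hff], by rw [← mul_assoc, hff], by rw [mul_assoc, hbe]⟩

/-- In a decomposition of `1` into orthogonal primitive idempotents of degree `0`, the number of
those that are equivalent to a given diagonal matrix unit is the dimension of its row space. -/
theorem card_homogEquiv_eq_finrank [IsScalarTower R A A] (he : IsMatrixIdempotent 𝒜 e)
    {ι : Type*} [Fintype ι] {f : ι → A} (hf : ∀ i, IsPrimitiveOfDegreeZero 𝒜 (f i))
    (hff : ∀ i, f i * f i = f i) (hne : ∀ i j, i ≠ j → f i * f j = 0) (hsum : ∑ i, f i = 1) :
    Nat.card {i // HomogEquiv 𝒜 0 e (f i)} = Module.finrank R he.rowSpace := by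
  classical
  -- The elements `u i` of an equivalence with `f i` form a basis of the row space.
  choose u hu v hv h₁ h₂ h₃ h₄ h₅ h₆ using fun i : {i // HomogEquiv 𝒜 0 e (f i)} => i.2
  have huv (i j) (hij : i ≠ j) : u i * v j = 0 := by
    rw [← h₄ i, ← h₅ j, mul_assoc, ← mul_assoc (f i), hne _ _ fun h => hij (Subtype.ext h),
      zero_mul, mul_zero]
  have hli : LinearIndependent R u := by
    rw [Fintype.linearIndependent_iff]
    intro r hr j
    have h := congrArg (· * v j) hr
    simp only [Finset.sum_mul, smul_mul_assoc, zero_mul] at h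
    rw [Finset.sum_eq_single j, h₁] at h
    · exact he.eq_zero_of_smul_eq_zero h
    · intro i _ hij
      rw [huv i j hij, smul_zero]
    · simp
  have hspan : Submodule.span R (Set.range u) = he.rowSpace := by
    refine le_antisymm (Submodule.span_le.2 ?_) fun a ha => ?_
    · rintro _ ⟨i, rfl⟩
      exact ⟨hu i, h₃ i⟩
    · rw [← mul_one a, ← hsum, Finset.mul_sum]
      refine sum_mem fun i _ => ?_
      by_cases h0 : a * f i = 0
      · rw [h0]
        exact zero_mem _
      · let i' : {i // HomogEquiv 𝒜 0 e (f i)} :=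
          ⟨i, he.homogEquiv_of_mul_ne_zero hmul (hf i) (hff i) ha.1 ha.2 h0⟩
        have hav : a * v i' ∈ 𝒜 0 := by
          have h := hmul ha.1 (hv i')
          rwa [neg_zero, add_zero] at h
        obtain ⟨r, hr⟩ := he.exists_eq_smul (a * v i') hav (by rw [← mul_assoc, ha.2])
          (by rw [mul_assoc, h₆])
        have h : a * f i = r • u i' := by
          rw [show f i = v i' * u i' from (h₂ i').symm, ← mul_assoc, hr, smul_mul_assoc, h₃]
        rw [h]
        exact Submodule.smul_mem _ r (Submodule.subset_span ⟨i', rfl⟩)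
  rw [← hspan, finrank_span_eq_card hli, Nat.card_eq_fintype_card]

/-- Two decompositions of `1` into orthogonal primitive idempotents of degree `0`, one of them
into diagonal matrix units, agree up to a permutation and equivalence. -/
theorem exists_equiv_homogEquiv [IsScalarTower R A A] {ι κ : Type*} [Fintype ι] [Fintype κ]
    {e : κ → A} (he : ∀ b, IsMatrixIdempotent 𝒜 (e b)) (hene : ∀ b b', b ≠ b' → e b * e b' = 0)
    (hesum : ∑ b, e b = 1) {f : ι → A} (hf : ∀ i, IsPrimitiveOfDegreeZero 𝒜 (f i))
    (hff : ∀ i, f i * f i = f i) (hne : ∀ i j, i ≠ j → f i * f j = 0) (hsum : ∑ i, f i = 1)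
    (hf0 : ∀ i, f i ≠ 0) : ∃ π : ι ≃ κ, ∀ i, HomogEquiv 𝒜 0 (e (π i)) (f i) := by
  have htrans {x y z : A} (h : HomogEquiv 𝒜 0 x y) (h' : HomogEquiv 𝒜 0 y z) :
      HomogEquiv 𝒜 0 x z := HomogEquiv.trans hmul h h'
  have hsymm {x y : A} (h : HomogEquiv 𝒜 0 x y) : HomogEquiv 𝒜 0 y x := by
    have h' := h.symm
    rwa [neg_zero] at h'
  have hex (i : ι) : ∃ b, HomogEquiv 𝒜 0 (e b) (f i) := by
    obtain ⟨b, hb⟩ : ∃ b, e b * f i ≠ 0 := by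
      by_contra! h
      refine hf0 i ?_
      rw [← one_mul (f i), ← hesum, Finset.sum_mul]
      exact Finset.sum_eq_zero fun b _ => h b
    exact ⟨b, (he b).homogEquiv_of_mul_ne_zero hmul (hf i) (hff i) (he b).mem (he b).mul_self hb⟩
  choose g hg using hex
  let S : Setoid κ :=
    { r := fun b b' => HomogEquiv 𝒜 0 (e b) (e b')
      iseqv := ⟨fun b => ⟨e b, (he b).mem, e b, by rw [neg_zero]; exact (he b).mem, by
        simp only [(he b).mul_self, and_self]⟩, hsymm, htrans⟩ }
  -- Both decompositions have as many members in a class as the row space has dimensions.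
  have hcard (c : Quotient S) : Nonempty
      ({i // Quotient.mk S (g i) = c} ≃ {b // Quotient.mk S b = c}) := by
    obtain ⟨b, rfl⟩ := Quotient.exists_rep c
    refine Finite.card_eq.1 ?_
    have h₁ (i : ι) : Quotient.mk S (g i) = Quotient.mk S b ↔ HomogEquiv 𝒜 0 (e b) (f i) :=
      Quotient.eq.trans ⟨fun h => htrans (hsymm h) (hg i), fun h => htrans (hg i) (hsymm h)⟩
    have h₂ (b' : κ) : Quotient.mk S b' = Quotient.mk S b ↔ HomogEquiv 𝒜 0 (e b) (e b') :=
      Quotient.eq.trans ⟨hsymm, hsymm⟩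
    rw [Nat.card_congr (Equiv.subtypeEquivRight h₁), Nat.card_congr (Equiv.subtypeEquivRight h₂),
      (he b).card_homogEquiv_eq_finrank hmul hf hff hne hsum,
      (he b).card_homogEquiv_eq_finrank hmul (fun b => (he b).isPrimitiveOfDegreeZero)
        (fun b => (he b).mul_self) hene hesum]
  let E c := (hcard c).some
  refine ⟨Equiv.ofFiberEquiv E, fun i => ?_⟩
  have h : HomogEquiv 𝒜 0 (e (Equiv.ofFiberEquiv E i)) (e (g i)) :=
    Quotient.exact (Equiv.ofFiberEquiv_map E i)
  exact htrans h (hg i)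

end IsMatrixIdempotent

end MatrixIdempotents

/-! ### Diagonal matrix units -/

section DiagonalIdempotents

universe x

/-- The diagonal matrix unit with index `a`. -/
noncomputable def diagUnit (R : Type x) [Ring R] {t : ℕ} {l n : Fin t → ℕ}
    (a : Σ s, Fin (n s)) : MatSum R l n :=
  matUnit R a.1 a.2 a.2 0

section Ring

variable {R : Type x} [Ring R] {t : ℕ} {l n : Fin t → ℕ}

theorem diagUnit_mul_diagUnit (a : Σ s, Fin (n s)) :
    diagUnit R a * diagUnit R a = (diagUnit R a : MatSum R l n) := by
  rw [diagUnit, matUnit_mul_matUnit, add_zero]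

theorem diagUnit_mul_diagUnit_of_ne {a b : Σ s, Fin (n s)} (h : a ≠ b) :
    diagUnit R a * diagUnit R b = (0 : MatSum R l n) := by
  obtain ⟨s, i⟩ := a
  obtain ⟨s', j⟩ := b
  simp only [diagUnit, matUnit]
  rw [mul_piSingle]
  by_cases hs : s = s'
  · subst hs
    have hij : i ≠ j := by
      rintro rfl
      exact h rfl
    rw [Pi.single_eq_same, Matrix.single_mul_single_of_ne _ _ _ _ hij, Pi.single_zero]
  · rw [Pi.single_eq_of_ne (Ne.symm hs), zero_mul, Pi.single_zero]

theorem sum_diagUnit : ∑ a, diagUnit R a = (1 : MatSum R l n) := by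
  rw [Fintype.sum_sigma, ← Finset.univ_sum_single (1 : MatSum R l n)]
  refine Finset.sum_congr rfl fun s _ => ?_
  rw [Pi.one_apply, ← Matrix.sum_single_one]
  exact (map_sum (AddMonoidHom.single
    (fun s => Matrix (Fin (n s)) (Fin (n s)) (LaurentPow R (l s))) s) _ _).symm

theorem diagUnit_mul_mul_diagUnit (s : Fin t) (i j : Fin (n s)) (A : MatSum R l n) :
    diagUnit R ⟨s, i⟩ * A * diagUnit R ⟨s, j⟩ = Pi.single s (Matrix.single i j (A s i j)) := by
  rw [diagUnit, diagUnit, matUnit, matUnit, piSingle_mul, ← Pi.single_mul,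
    Matrix.single_mul_mul_single]
  simp [← AddMonoidAlgebra.one_def]

theorem diagUnit_mul_mul_diagUnit_of_ne {a b : Σ s, Fin (n s)} (h : a.1 ≠ b.1)
    (A : MatSum R l n) : diagUnit R a * A * diagUnit R b = 0 := by
  rw [diagUnit, diagUnit, matUnit, matUnit, piSingle_mul, mul_piSingle,
    Pi.single_eq_of_ne (Ne.symm h), zero_mul, Pi.single_zero]

theorem diagUnit_mul_apply (a : Σ s, Fin (n s)) (A : MatSum R l n) (s : Fin t)
    (i j : Fin (n s)) : (diagUnit R a * A : MatSum R l n) s i j = if a = ⟨s, i⟩ then A s i j else 0 := by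
  obtain ⟨s', i'⟩ := a
  rw [diagUnit, matUnit, piSingle_mul]
  by_cases hs : s = s'
  · subst hs
    rw [Pi.single_eq_same]
    by_cases hi : i = i'
    · subst hi
      rw [Matrix.single_mul_apply_same, if_pos rfl, ← AddMonoidAlgebra.one_def, one_mul]
    · rw [Matrix.single_mul_apply_of_ne _ _ _ _ _ hi, if_neg (by simpa using Ne.symm hi)]
  · rw [Pi.single_eq_of_ne hs, if_neg fun h => hs (Sigma.mk.inj_iff.1 h).1.symm]
    rfl

theorem matUnit_mem_grading {δ : ∀ s, Fin (n s) → ℤ} {s : Fin t} {i j : Fin (n s)}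
    {z : AddSubgroup.zmultiples (l s : ℤ)} {k : ℤ} (hz : (z : ℤ) = k + δ s j - δ s i) (r : R) :
    (Pi.single s (Matrix.single i j (AddMonoidAlgebra.single z r)) : MatSum R l n) ∈
      matSumGrading R l n δ k := by
  rw [mem_matSumGrading]
  intro s' i' j'
  by_cases hs : s' = s
  · subst hs
    rw [Pi.single_eq_same, Matrix.single_apply]
    split_ifs with h
    · obtain ⟨rfl, rfl⟩ := h
      rw [← hz]
      exact LaurentPow.single_mem_grading z r
    · exact zero_mem _
  · rw [Pi.single_eq_of_ne hs]
    exact zero_mem _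

theorem diagUnit_mem_grading (δ : ∀ s, Fin (n s) → ℤ) (a : Σ s, Fin (n s)) :
    (diagUnit R a : MatSum R l n) ∈ matSumGrading R l n δ 0 :=
  matUnit_mem_grading (by simp) 1

theorem matUnit_ne_zero [Nontrivial R] (s : Fin t) (i j : Fin (n s))
    (z : AddSubgroup.zmultiples (l s : ℤ)) : (matUnit R s i j z : MatSum R l n) ≠ 0 := by
  intro h
  have h' := congrFun (congrFun (congrFun h s) i) j
  simp [matUnit] at h'

/-- An equivalence in degree `k` exists exactly if the entry of degree `k` with these indices can be
a nonzero monomial. -/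
theorem homogEquiv_diagUnit_iff [Nontrivial R] (δ : ∀ s, Fin (n s) → ℤ) (k : ℤ)
    (a b : Σ s, Fin (n s)) :
    HomogEquiv (matSumGrading R l n δ) k (diagUnit R a) (diagUnit R b) ↔
      a.1 = b.1 ∧ k + δ b.1 b.2 - δ a.1 a.2 ∈ AddSubgroup.zmultiples (l a.1 : ℤ) := by
  obtain ⟨s, i⟩ := a
  obtain ⟨s', j⟩ := b
  constructor
  · rintro ⟨u, hu, v, hv, h₁, h₂, h₃, h₄, -, -⟩
    have hu' : diagUnit R ⟨s, i⟩ * u * diagUnit R ⟨s', j⟩ = u := by rw [h₃, h₄]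
    have hu0 : u ≠ 0 := by
      rintro rfl
      rw [zero_mul] at h₁
      exact matUnit_ne_zero s i i 0 h₁.symm
    by_cases hs : s = s'
    · subst hs
      refine ⟨rfl, ?_⟩
      rw [diagUnit_mul_mul_diagUnit] at hu'
      rcases LaurentPow.eq_zero_or_eq_single (mem_matSumGrading.1 hu s i j) with h | ⟨z, hz, -⟩
      · rw [h, Matrix.single_zero, Pi.single_zero] at hu'
        exact absurd hu'.symm hu0
      · rw [← hz]
        exact z.2
    · rw [diagUnit_mul_mul_diagUnit_of_ne hs] at hu'
      exact absurd hu'.symm hu0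
  · rintro ⟨h, hk⟩
    obtain rfl : s = s' := h
    refine ⟨matUnit R s i j ⟨_, hk⟩, matUnit_mem_grading rfl 1, matUnit R s j i (-⟨_, hk⟩),
      matUnit_mem_grading (by simp only [NegMemClass.coe_neg]; ring) 1, ?_⟩
    simp only [diagUnit, matUnit_mul_matUnit, add_zero, zero_add, add_neg_cancel, neg_add_cancel,
      and_self]

end Ring

section DivisionRing

variable {R : Type x} [DivisionRing R] {t : ℕ} {l n : Fin t → ℕ} {δ : ∀ s, Fin (n s) → ℤ}

theorem diagUnit_mul_smul (b : Σ s, Fin (n s)) (r : R) (A : MatSum R l n) :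
    diagUnit R b * r • A = r • (diagUnit R b * A) := by
  funext s
  ext1 i j
  rw [diagUnit_mul_apply, Pi.smul_apply, Pi.smul_apply, Matrix.smul_apply, Matrix.smul_apply,
    diagUnit_mul_apply]
  split_ifs
  · rfl
  · rw [smul_zero]

/-- The corner of degree `0` at a diagonal matrix unit is the division ring `R`. -/
theorem exists_eq_smul_diagUnit (b : Σ s, Fin (n s)) (A : MatSum R l n)
    (hA : A ∈ matSumGrading R l n δ 0) (h₁ : diagUnit R b * A = A)
    (h₂ : A * diagUnit R b = A) : ∃ r : R, A = r • diagUnit R b := by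
  obtain ⟨s, i⟩ := b
  have h : Pi.single s (Matrix.single i i (A s i i)) = A := by
    rw [← diagUnit_mul_mul_diagUnit, h₁, h₂]
  rcases LaurentPow.eq_zero_or_eq_single (mem_matSumGrading.1 hA s i i) with h' | ⟨z, hz, r, -, h'⟩
  · refine ⟨0, ?_⟩
    rw [← h, h', Matrix.single_zero, Pi.single_zero, zero_smul]
  · obtain rfl : z = 0 := Subtype.ext (by simpa using hz)
    refine ⟨r, ?_⟩
    rw [← h, h', single_single_eq_smul_matUnit, diagUnit]

/-- A nonzero row of degree `0` can be multiplied to a diagonal matrix unit. -/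
theorem exists_mul_eq_diagUnit (b : Σ s, Fin (n s)) (A : MatSum R l n)
    (hA : A ∈ matSumGrading R l n δ 0) (hbA : diagUnit R b * A = A) (h0 : A ≠ 0) :
    ∃ N ∈ matSumGrading R l n δ 0, A * N = diagUnit R b ∧ N * diagUnit R b = N := by
  obtain ⟨s, i⟩ := b
  obtain ⟨j, hj⟩ : ∃ j, A s i j ≠ 0 := by
    by_contra! h
    refine h0 (funext fun s' => Matrix.ext fun i' j' => ?_)
    rw [← hbA, diagUnit_mul_apply]
    split_ifs with hb
    · obtain ⟨rfl, hb⟩ := Sigma.mk.inj_iff.1 hb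
      obtain rfl := eq_of_heq hb
      exact h j'
    · rfl
  obtain ⟨z, hz, r, hr, h⟩ :=
    (LaurentPow.eq_zero_or_eq_single (mem_matSumGrading.1 hA s i j)).resolve_left hj
  refine ⟨Pi.single s (Matrix.single j i (AddMonoidAlgebra.single (-z) r⁻¹)),
    matUnit_mem_grading (by rw [NegMemClass.coe_neg, hz]; ring) _, ?_, ?_⟩
  · rw [← hbA, diagUnit, matUnit, piSingle_mul, ← Pi.single_mul,
      Matrix.single_mul_mul_single, h, AddMonoidAlgebra.single_mul_single,
      AddMonoidAlgebra.single_mul_single, one_mul, mul_inv_cancel₀ hr, zero_add, add_neg_cancel]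
  · rw [diagUnit, matUnit, ← Pi.single_mul, Matrix.single_mul_single_same,
      AddMonoidAlgebra.single_mul_single, add_zero, mul_one]

theorem isMatrixIdempotent_diagUnit (b : Σ s, Fin (n s)) :
    IsMatrixIdempotent (matSumGrading R l n δ) (diagUnit R b) where
  mem := diagUnit_mem_grading δ b
  mul_self := diagUnit_mul_diagUnit b
  mul_smul := diagUnit_mul_smul b
  exists_mul_eq := exists_mul_eq_diagUnit b
  exists_eq_smul := exists_eq_smul_diagUnit b
  ne_zero := matUnit_ne_zero _ _ _ _

/-- A graded isomorphism permutes the diagonal matrix units up to equivalence, and so preserves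
all the relations of homogeneous equivalence among them. -/
theorem exists_equiv_of_gradedRingIso {t' : ℕ} {l' m : Fin t' → ℕ} {γ : ∀ s, Fin (m s) → ℤ}
    (h : GradedRingIso (matSumGrading R l n δ) (matSumGrading R l' m γ)) :
    ∃ π : (Σ s, Fin (n s)) ≃ Σ s, Fin (m s), ∀ (k : ℤ) (a b : Σ s, Fin (n s)),
      (a.1 = b.1 ∧ k + δ b.1 b.2 - δ a.1 a.2 ∈ AddSubgroup.zmultiples (l a.1 : ℤ)) ↔
        ((π a).1 = (π b).1 ∧ k + γ (π b).1 (π b).2 - γ (π a).1 (π a).2 ∈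
          AddSubgroup.zmultiples (l' (π a).1 : ℤ)) := by
  obtain ⟨φ, hφ⟩ := h
  obtain ⟨π, hπ⟩ := IsMatrixIdempotent.exists_equiv_homogEquiv
    (𝒜 := matSumGrading R l' m γ) (fun ha hb => mul_mem_matSumGrading ha hb)
    (fun b => isMatrixIdempotent_diagUnit b) (fun _ _ h => diagUnit_mul_diagUnit_of_ne h)
    sum_diagUnit (f := fun a : Σ s, Fin (n s) => φ (diagUnit R a))
    (fun a => (isMatrixIdempotent_diagUnit a).isPrimitiveOfDegreeZero.map hφ)
    (fun a => by rw [← map_mul, diagUnit_mul_diagUnit])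
    (fun a b h => by rw [← map_mul, diagUnit_mul_diagUnit_of_ne h, map_zero])
    (by rw [← map_sum, sum_diagUnit, map_one])
    (fun a => (map_ne_zero_iff φ φ.injective).2 (matUnit_ne_zero _ _ _ _))
  refine ⟨π, fun k a b => ?_⟩
  rw [← homogEquiv_diagUnit_iff (R := R), ← homogEquiv_diagUnit_iff (R := R),
    ← homogEquiv_map_iff hφ]
  have htrans {k k' : ℤ} {x y z : MatSum R l' m}
      (h : HomogEquiv (matSumGrading R l' m γ) k x y)
      (h' : HomogEquiv (matSumGrading R l' m γ) k' y z) :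
      HomogEquiv (matSumGrading R l' m γ) (k + k') x z :=
    HomogEquiv.trans (fun ha hb => mul_mem_matSumGrading ha hb) h h'
  constructor
  · intro h
    have h' := htrans (htrans (hπ a) h) (hπ b).symm
    rwa [neg_zero, add_zero, zero_add] at h'
  · intro h
    have h' := htrans (htrans (hπ a).symm h) (hπ b)
    rwa [neg_zero, add_zero, zero_add] at h'

end DivisionRing

end DiagonalIdempotents

/-! ### Recovering the degrees from the equivalence relations -/

/-- The relations of homogeneous equivalence among the diagonal matrix units determine the blocks,
the lengths of the cycles, and the degrees up to the allowed changes. -/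
theorem exists_shiftRelated_of_equiv {t t' : ℕ} {l n : Fin t → ℕ} {l' m : Fin t' → ℕ}
    {δ : ∀ s, Fin (n s) → ℤ} {γ : ∀ s, Fin (m s) → ℤ} (hn : ∀ s, 0 < n s) (hm : ∀ s, 0 < m s)
    (π : (Σ s, Fin (n s)) ≃ Σ s, Fin (m s))
    (hπ : ∀ (k : ℤ) (a b : Σ s, Fin (n s)),
      (a.1 = b.1 ∧ k + δ b.1 b.2 - δ a.1 a.2 ∈ AddSubgroup.zmultiples (l a.1 : ℤ)) ↔
        ((π a).1 = (π b).1 ∧ k + γ (π b).1 (π b).2 - γ (π a).1 (π a).2 ∈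
          AddSubgroup.zmultiples (l' (π a).1 : ℤ))) :
    t' = t ∧ ∃ ρ : Fin t ≃ Fin t', ∀ s, l s = l' (ρ s) ∧ n s = m (ρ s) ∧
      ShiftRelated (l s) (δ s) (γ (ρ s)) := by
  -- For a suitable degree the congruence holds trivially, so that only the blocks matter.
  have hblock (a b : Σ s, Fin (n s)) : a.1 = b.1 ↔ (π a).1 = (π b).1 := by
    refine ⟨fun h => ?_, fun h => ?_⟩
    · exact ((hπ (δ a.1 a.2 - δ b.1 b.2) a b).1 ⟨h, by simp⟩).1
    · exact ((hπ (γ (π a).1 (π a).2 - γ (π b).1 (π b).2) a b).2 ⟨h, by simp⟩).1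
  let ρ (s : Fin t) : Fin t' := (π ⟨s, 0, hn s⟩).1
  have hρ (a : Σ s, Fin (n s)) : (π a).1 = ρ a.1 := (hblock a ⟨a.1, 0, hn a.1⟩).1 rfl
  have hinj : Function.Injective ρ := fun s s' h =>
    (hblock ⟨s, 0, hn s⟩ ⟨s', 0, hn s'⟩).2 h
  have hsurj : Function.Surjective ρ := fun s' => by
    refine ⟨(π.symm ⟨s', 0, hm s'⟩).1, ?_⟩
    rw [← hρ, Equiv.apply_symm_apply]
  let ρ' : Fin t ≃ Fin t' := Equiv.ofBijective ρ ⟨hinj, hsurj⟩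
  refine ⟨by simpa using (Fintype.card_congr ρ').symm, ρ', fun s => ?_⟩
  change l s = l' (ρ s) ∧ n s = m (ρ s) ∧ ShiftRelated (l s) (δ s) (γ (ρ s))
  have hl : l s = l' (ρ s) := by
    have h (k : ℤ) : k ∈ AddSubgroup.zmultiples (l s : ℤ) ↔
        k ∈ AddSubgroup.zmultiples (l' (ρ s) : ℤ) := by
      simpa [ρ] using hπ k ⟨s, 0, hn s⟩ ⟨s, 0, hn s⟩
    refine Nat.dvd_antisymm ?_ ?_
    · exact Int.natCast_dvd_natCast.1 (Int.mem_zmultiples_iff.1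
        ((h _).2 (AddSubgroup.mem_zmultiples _)))
    · exact Int.natCast_dvd_natCast.1 (Int.mem_zmultiples_iff.1
        ((h _).1 (AddSubgroup.mem_zmultiples _)))
  have hfib (i : Fin (n s)) : ∃ j : Fin (m (ρ s)), π ⟨s, i⟩ = ⟨ρ s, j⟩ := by
    have h := hρ ⟨s, i⟩
    generalize π ⟨s, i⟩ = b at h
    obtain ⟨s', j⟩ := b
    obtain rfl : s' = ρ s := h
    exact ⟨j, rfl⟩
  choose e he using hfib
  have hebij : Function.Bijective e := by
    refine ⟨fun i i' h => ?_, fun j => ?_⟩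
    · have h' : π ⟨s, i⟩ = π ⟨s, i'⟩ := by rw [he, he, h]
      simpa using π.injective h'
    · obtain ⟨⟨s', i⟩, hi⟩ := π.surjective ⟨ρ s, j⟩
      obtain rfl : s' = s := hinj (by rw [← hρ ⟨s', i⟩, hi])
      refine ⟨i, ?_⟩
      rw [he] at hi
      simpa using hi
  let e' : Fin (n s) ≃ Fin (m (ρ s)) := Equiv.ofBijective e hebij
  refine ⟨hl, by simpa using Fintype.card_congr e', e',
    δ s ⟨0, hn s⟩ - γ (ρ s) (e ⟨0, hn s⟩), fun i =>
      ⟨δ s i - δ s ⟨0, hn s⟩ + γ (ρ s) (e ⟨0, hn s⟩) - γ (ρ s) (e i), ?_, ?_⟩⟩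
  · have h := ((hπ (δ s i - δ s ⟨0, hn s⟩) ⟨s, i⟩ ⟨s, 0, hn s⟩).1 ⟨rfl, by simp⟩).2
    rwa [he, he, ← hl] at h
  · change δ s i = γ (ρ s) (e i) + _ + _
    ring

theorem CycleChoice.n_pos {V : Type*} [Quiver V] (hV : IsMultiHeadedComet V) {t : ℕ}
    (C : CycleChoice V t) (s : Fin t) : 0 < C.n s := by
  have := C.finite_pathsTo hV s
  have : Nonempty (C.PathsTo s) := ⟨C.nilPath s⟩
  exact Nat.card_pos

end LPA

theorem mainTheorem5 :
    (∀ (R : Type*) [Ring R] (V : Type*) [Quiver.{_} V], LPA.IsMultiHeadedComet V →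
      ∀ (t : ℕ) (C : LPA.CycleChoice V t),
        (∀ s, Finite (C.PathsTo s)) ∧
        ∀ p : C.PathEnum,
          LPA.GradedAlgIso (LPA.Leavitt.grading R V)
            (LPA.matSumGrading R C.len C.n (LPA.CycleChoice.pathLengths p))) ∧
    (∀ (R : Type*) [DivisionRing R] (V : Type*) [Quiver.{_} V] (W : Type*) [Quiver.{_} W],
      LPA.IsMultiHeadedComet V → LPA.IsMultiHeadedComet W →
      ∀ (t k : ℕ) (C : LPA.CycleChoice V t) (D : LPA.CycleChoice W k)
        (p : C.PathEnum) (q : D.PathEnum),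
        (LPA.GradedRingIso (LPA.Leavitt.grading R V) (LPA.Leavitt.grading R W) ↔
          k = t ∧ ∃ π : Fin t ≃ Fin k, ∀ s,
            C.len s = D.len (π s) ∧ C.n s = D.n (π s) ∧
            LPA.ShiftRelated (C.len s) (LPA.CycleChoice.pathLengths p s)
              (LPA.CycleChoice.pathLengths q (π s))) ∧
        (LPA.GradedAlgIso (LPA.Leavitt.grading R V) (LPA.Leavitt.grading R W) ↔
          k = t ∧ ∃ π : Fin t ≃ Fin k, ∀ s,
            C.len s = D.len (π s) ∧ C.n s = D.n (π s) ∧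
            LPA.ShiftRelated (C.len s) (LPA.CycleChoice.pathLengths p s)
              (LPA.CycleChoice.pathLengths q (π s)))) := by
  refine ⟨fun R _ V _ hV t C => ⟨fun s => C.finite_pathsTo hV s, fun p =>
    LPA.leavitt_gradedAlgIso_matSum R hV C p⟩, fun R _ V _ W _ hV hW t k C D p q => ?_⟩
  have hC := LPA.leavitt_gradedAlgIso_matSum R hV C p
  have hD := LPA.leavitt_gradedAlgIso_matSum R hW D q
  have hring (h : LPA.GradedRingIso (LPA.Leavitt.grading R V) (LPA.Leavitt.grading R W)) :
      k = t ∧ ∃ π : Fin t ≃ Fin k, ∀ s, C.len s = D.len (π s) ∧ C.n s = D.n (π s) ∧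
        LPA.ShiftRelated (C.len s) (LPA.CycleChoice.pathLengths p s)
          (LPA.CycleChoice.pathLengths q (π s)) := by
    obtain ⟨π, hπ⟩ := LPA.exists_equiv_of_gradedRingIso
      ((hC.symm.gradedRingIso.trans h).trans hD.gradedRingIso)
    exact LPA.exists_shiftRelated_of_equiv (C.n_pos hV) (D.n_pos hW) π hπ
  have halg (h : k = t ∧ ∃ π : Fin t ≃ Fin k, ∀ s, C.len s = D.len (π s) ∧ C.n s = D.n (π s) ∧
      LPA.ShiftRelated (C.len s) (LPA.CycleChoice.pathLengths p s)
        (LPA.CycleChoice.pathLengths q (π s))) :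
      LPA.GradedAlgIso (LPA.Leavitt.grading R V) (LPA.Leavitt.grading R W) := by
    obtain ⟨-, π, h⟩ := h
    exact (hC.trans (LPA.gradedAlgIso_matSum_of_shiftRelated R π
      fun s => ⟨(h s).1, (h s).2.2⟩)).trans hD.symm
  exact ⟨⟨hring, fun h => (halg h).gradedRingIso⟩, ⟨fun h => hring h.gradedRingIso, halg⟩⟩
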